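/- Fix a saturated model $(\mathcal U,\delta)$ of $\mathrm{DCF}_0$ (differentially closed fields of characteristic $0$), with field of constants $\mathcal U^\delta$, and an embedding $\mathbb C\subset\mathcal U^\delta$. Let $k$ be a countable subfield of $\mathbb C$ and let $\pi:(\mathcal X,v)\to(S,0)$ be a $k$-algebraic family of varieties endowed with vector fields with constant coefficients, that is, $\mathcal X$ and $S$ are algebraic varieties over $k$, $v$ is a vector field on $\mathcal X$ (a $k$-linear derivation of $\mathcal O_{\mathcal X}$), and $\pi$ is a surjective morphism of $k$-varieties with $d\pi(v)=0$. For $s\in S(\mathcal U^\delta)$ let $$(\mathcal X,v)_s^\delta=\{x\in\mathcal X(\mathcal U)\ :\ \pi(x)=s,\ \nabla(x)=v(x)\},$$ where $\nabla(x)$ is the tangent vector $f\mapsto\delta(f(x))$ at $x$, and let $\mathcal P(s)$ be the property that the definable set $(\mathcal X,v)_s^\delta$ is strongly minimal and disintegrated: it is infinite, each of its subsets definable with parameters in $\mathcal U$ is finite or cofinite in it, and whenever $x\in(\mathcal X,v)_s^\delta$ is algebraic (in the model-theoretic sense) over $k(s)\cup A$ with $A\subset(\mathcal X,v)_s^\delta$,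 then $x$ is algebraic over $k(s)$ or over $k(s)\cup\{a\}$ for some $a\in A$. Assume that $S$ is irreducible. Then the following are equivalent: (i) The property $\mathcal P(s)$ holds on a measurable set of parameters $s\in S(\mathbb C)$ of positive Lebesgue measure (the Lebesgue measure class being defined by local analytic coordinates on the smooth locus of $S$, the singular locus having measure zero). (ii) The property $\mathcal P(s)$ holds on a somewhere dense $G_\delta$-set of $S(\mathbb C)^{an}$: it holds on a countable intersection $A=\bigcap_i U_i$ of open sets $U_i$ of $S(\mathbb C)$ with its analytic topology such that $\overline A$ has non-empty interior. (iii) The property $\mathcal P(s)$ holds for some realization $s$ of the generic type of $S$ over $k$ (in the sense of $\mathrm{ACF}_0$), that is, for some point $s$ lying on no proper closed subvariety of $S$ defined over $k$. (iv) The property $\mathcal P(s)$ holds for every realization $s$ of the generic type of $S$ over $k$. In (iii) and (iv) the realizations may be taken either in $S(\mathbb C)$ or in $S(\mathcal U^\delta)$; all the resulting conditions are equivalent. -/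

import Mathlib

open CategoryTheory AlgebraicGeometry
open scoped Differential

/-! ### Differential fields and the language of differential rings -/

/-- Function symbols of the language of differential rings. -/
inductive DiffRingFunc : ℕ → Type
  | zero : DiffRingFunc 0
  | one : DiffRingFunc 0
  | neg : DiffRingFunc 1
  | deriv : DiffRingFunc 1
  | add : DiffRingFunc 2
  | mul : DiffRingFunc 2

/-- The first-order language of differential rings. -/
def diffRingLang : FirstOrder.Language := ⟨DiffRingFunc, fun _ => Empty⟩

/-- A differential ring as a structure in the language of differential rings. -/
instance diffRingStructure (K : Type*) [CommRing K] [Differential K] : diffRingLang.Structure K where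
  funMap f x := match f, x with
    | .zero, _ => 0
    | .one, _ => 1
    | .neg, x => -x 0
    | .deriv, x => (x 0)′
    | .add, x => x 0 + x 1
    | .mul, x => x 0 * x 1
  RelMap r _ := r.elim

/-- Differentially closed field of characteristic zero: an existentially closed differential
field. Every quantifier-free formula with parameters in `K` that has a solution in some
differential field extension `L` of `K` already has a solution in `K`. -/
def IsDifferentiallyClosed (K : Type) [Field K] [Differential K] : Prop :=
  CharZero K ∧
    ∀ (L : Type) [Field L] [Differential L] (e : K →+* L), (∀ x : K, e (x′) = (e x)′) →
      ∀ (n : ℕ) (φ : diffRingLang.Formula (K ⊕ Fin n)), φ.IsQF →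
        (∃ y : Fin n → L, φ.Realize (Sum.elim (fun a => e a) y)) →
          ∃ y : Fin n → K, φ.Realize (Sum.elim id y)

/-- Saturation: for every parameter set `A` of cardinality smaller than that of the model, a
family of `A`-definable subsets with the finite intersection property has a common point. -/
def IsSaturatedModel (L : FirstOrder.Language) (M : Type*) [L.Structure M] : Prop :=
  ∀ A : Set M, Cardinal.mk A < Cardinal.mk M →
    ∀ F : Set (Set M), (∀ E ∈ F, A.Definable₁ L E) →
      (∀ G : Finset (Set M), (G : Set (Set M)) ⊆ F → (⋂₀ (G : Set (Set M))).Nonempty) →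
        (⋂₀ F).Nonempty

/-- The field of constants of a differential field. -/
def constantField (K : Type*) [Field K] [Differential K] : Subfield K where
  carrier := {x | x′ = 0}
  zero_mem' := by simp
  one_mem' := by simp
  add_mem' := by
    intro a b ha hb
    simp only [Set.mem_ofPred_eq] at *
    simp [ha, hb]
  mul_mem' := by
    intro a b ha hb
    simp only [Set.mem_ofPred_eq] at *
    simp [ha, hb]
  neg_mem' := by
    intro a ha
    simp only [Set.mem_ofPred_eq] at *
    simp [ha]
  inv_mem' := by
    intro a ha
    simp only [Set.mem_ofPred_eq] at *
    rw [Derivation.leibniz_inv]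
    simp [ha]

/-! ### Varieties, points and vector fields -/

noncomputable section

/-- `p : X ⟶ Spec k` is an algebraic variety over the field `k` (not necessarily irreducible). -/
structure IsVariety {k : Type} [Field k] {X : Scheme.{0}} (p : X ⟶ Spec (.of k)) : Prop where
  reduced : IsReduced X
  separated : IsSeparated p
  locallyOfFiniteType : LocallyOfFiniteType p
  quasiCompact : QuasiCompact p

/-- The structure map `k → Γ(X, V)` of a scheme over `k`. -/
def scalarHom {k : Type} [Field k] {X : Scheme.{0}} (p : X ⟶ Spec (.of k)) (V : X.Opens) :
    k →+* Γ(X, V) :=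
  ((Scheme.ΓSpecIso (.of k)).inv ≫ p.appLE ⊤ V (by simp)).hom

/-- The set `X(F)` of `F`-points of a `k`-scheme `X`, for a field extension `φ : k → F`. -/
def FPoint {k : Type} [Field k] {X : Scheme.{0}} (p : X ⟶ Spec (.of k))
    {F : Type} [Field F] (φ : k →+* F) : Type :=
  {x : Spec (.of F) ⟶ X // x ≫ p = Spec.map (CommRingCat.ofHom φ)}

namespace FPoint

variable {k : Type} [Field k] {X : Scheme.{0}} {p : X ⟶ Spec (.of k)}
  {F : Type} [Field F] {φ : k →+* F}

/-- The point of the underlying space of `X` at which an `F`-point is located. -/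
def pt (x : FPoint p φ) : X := x.1 (IsLocalRing.closedPoint F)

/-- The homomorphism from the local ring of `X` at `x` to `F` given by evaluation at `x`. -/
def stalkHom (x : FPoint p φ) : X.presheaf.stalk x.pt →+* F :=
  (Scheme.stalkClosedPointTo x.1).hom

/-- The value at `x` of regular functions on an open neighbourhood `V` of `x`. -/
def eval (x : FPoint p φ) (V : X.Opens) (h : x.pt ∈ V) : Γ(X, V) →+* F :=
  x.stalkHom.comp (X.presheaf.germ V x.pt h).hom

/-- The subfield `k(x)` of `F`: the image of the residue field at `x`, generated over `k` by the
coordinates of `x` in any affine chart. -/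
def field (x : FPoint p φ) : Set F := Set.range x.stalkHom

/-- Base change of points along a field extension `ψ : F → F'`. -/
def baseChange {F' : Type} [Field F'] (ψ : F →+* F') (x : FPoint p φ) :
    FPoint p (ψ.comp φ) :=
  ⟨Spec.map (CommRingCat.ofHom ψ) ≫ x.1, by
    rw [Category.assoc, x.2, ← Spec.map_comp, ← CommRingCat.ofHom_comp]⟩

/-- `x` realizes the generic type of `X` over `k`: it lies on no proper closed subset of the
`k`-scheme `X`. -/
def IsGeneric (x : FPoint p φ) : Prop :=
  ∀ Z : Set X, IsClosed Z → x.pt ∈ Z → Z = Set.univ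

/-- The tuples of values `(f₁(x), …, fₙ(x))` for `x ∈ E` lying in the open set `W`. -/
def coordImage (E : Set (FPoint p φ)) (W : X.Opens) {n : ℕ} (f : Fin n → Γ(X, W)) :
    Set (Fin n → F) :=
  {y | ∃ x ∈ E, ∃ h : x.pt ∈ W, y = fun i => x.eval W h (f i)}

/-- The analytic topology on `X(F)`, when `F` is a topological field such as `ℂ`: it is generated
by the sets `{x ∈ V : f(x) ∈ O}` for `V` open in `X`, `f` regular on `V` and `O` open in `F`. -/
instance analyticTopology [TopologicalSpace F] : TopologicalSpace (FPoint p φ) :=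
  TopologicalSpace.generateFrom
    {A | ∃ (V : X.Opens) (f : Γ(X, V)) (O : Set F), IsOpen O ∧
      A = {x | ∃ h : x.pt ∈ V, x.eval V h f ∈ O}}

end FPoint

/-- A vector field on the `k`-variety `X`: a `k`-linear derivation of the structure sheaf. -/
structure VectorField {k : Type} [Field k] {X : Scheme.{0}} (p : X ⟶ Spec (.of k)) where
  app (V : X.Opens) : Derivation ℤ Γ(X, V) Γ(X, V)
  app_scalar (V : X.Opens) (c : k) : app V (scalarHom p V c) = 0
  app_res {V W : X.Opens} (i : W ≤ V) (f : Γ(X, V)) :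
    app W (X.presheaf.map (homOfLE i).op f) = X.presheaf.map (homOfLE i).op (app V f)

instance {k : Type} [Field k] {X : Scheme.{0}} (p : X ⟶ Spec (.of k)) : Zero (VectorField p) where
  zero := { app := fun _ => 0, app_scalar := by simp, app_res := by simp }

/-- A family over `k` of varieties endowed with vector fields with constant coefficients: a
surjective morphism `π : (X, v) ⟶ (S, 0)` of `k`-varieties endowed with vector fields. -/
structure VectorFieldFamily (k : Type) [Field k] where
  X : Scheme.{0}
  S : Scheme.{0}
  pX : X ⟶ Spec (.of k)
  pS : S ⟶ Spec (.of k)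
  variety_X : IsVariety pX
  variety_S : IsVariety pS
  v : VectorField pX
  π : X ⟶ S
  π_over : π ≫ pS = pX
  π_surjective : Surjective π
  π_vectorField : ∀ (V : S.Opens) (b : Γ(S, V)),
    v.app (π ⁻¹ᵁ V) (π.app V b) = π.app V ((0 : VectorField pS).app V b)

/-! ### Model theory of the solution sets -/

section DifferentialPoints

variable {k : Type} [Field k] {X : Scheme.{0}} {p : X ⟶ Spec (.of k)}
  {K : Type} [Field K] [Differential K] {φ : k →+* K}

/-- A subset of `X(K)` is definable over `C ⊆ K` in the differential field `K` if in every affine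
chart `W`, embedded in affine space by generators `f₁, …, fₙ` of the `k`-algebra `Γ(X, W)`, it is
a `C`-definable set of `n`-tuples. (Used for `C` containing `k`.) -/
def DefinableOver (C : Set K) (E : Set (FPoint p φ)) : Prop :=
  ∀ W : X.Opens, IsAffineOpen W → ∀ (n : ℕ) (f : Fin n → Γ(X, W)),
    Function.Surjective (MvPolynomial.eval₂Hom (scalarHom p W) f) →
      C.Definable diffRingLang (FPoint.coordImage E W f)

/-- `x` is model-theoretically algebraic over `C`: it lies in a finite `C`-definable set. -/
def AlgebraicOver (C : Set K) (x : FPoint p φ) : Prop :=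
  ∃ E : Set (FPoint p φ), E.Finite ∧ DefinableOver C E ∧ x ∈ E

/-- Strong minimality (in a saturated model `K`): `D` is infinite and every subset of `D` that is
definable with parameters in `K` is finite or cofinite in `D`. -/
def IsStronglyMinimalSet (D : Set (FPoint p φ)) : Prop :=
  D.Infinite ∧ ∀ E ⊆ D, DefinableOver Set.univ E → E.Finite ∨ (D \ E).Finite

/-- Disintegration of a set `D` defined over `C`: for every set `A` of elements of `D`, an element
of `D` that is algebraic over `C ∪ A` is algebraic over `C` or over `C ∪ {a}` for a single
`a ∈ A`. -/
def IsDisintegratedOver (C : Set K) (D : Set (FPoint p φ)) : Prop :=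
  ∀ A ⊆ D, ∀ x ∈ D, AlgebraicOver (C ∪ ⋃ a ∈ A, a.field) x →
    AlgebraicOver C x ∨ ∃ a ∈ A, AlgebraicOver (C ∪ a.field) x

end DifferentialPoints

namespace VectorFieldFamily

variable {k : Type} [Field k] (fam : VectorFieldFamily k)
  {K : Type} [Field K] [Differential K] {φ : k →+* constantField K}

/-- The set of solutions in `K` of the fibre of the family over a constant point `s` of the base:
the `K`-points `x` of `X` above `s` with `∇(x) = v(x)`, that is, such that the tangent vectors
`f ↦ (f(x))′` and `f ↦ (v f)(x)` at `x` agree. -/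
def solutions (s : FPoint fam.pS φ) :
    Set (FPoint fam.pX ((constantField K).subtype.comp φ)) :=
  {x | x.1 ≫ fam.π = (s.baseChange (constantField K).subtype).1 ∧
    ∀ (W : fam.X.Opens) (h : x.pt ∈ W) (f : Γ(fam.X, W)),
      (x.eval W h f)′ = x.eval W h (fam.v.app W f)}

/-- The property `P(s)`: the set of solutions of the fibre over `s`, which is definable over the
field `k(s)`, is strongly minimal and disintegrated. -/
def StronglyMinimalDisintegratedAt (s : FPoint fam.pS φ) : Prop :=
  IsStronglyMinimalSet (fam.solutions s) ∧
    IsDisintegratedOver (s.baseChange (constantField K).subtype).field (fam.solutions s)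

end VectorFieldFamily

/-! ### The Lebesgue measure class on the complex points of a variety -/

section Lebesgue

variable {k : Type} [Field k] {S : Scheme.{0}} {p : S ⟶ Spec (.of k)} {φ : k →+* ℂ}

/-- `A ⊆ S(ℂ)` has Lebesgue measure zero: in any étale coordinates `f₁, …, f_d` on an affine open
set `W` (these cover the smooth locus of `S`, and are local analytic charts on it), the image of
`A ∩ W(ℂ)` in `ℂ^d` has Lebesgue measure zero. -/
def LebesgueNull (A : Set (FPoint p φ)) : Prop :=
  ∀ W : S.Opens, IsAffineOpen W → ∀ (d : ℕ) (f : Fin d → Γ(S, W)),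
    (MvPolynomial.eval₂Hom (scalarHom p W) f).Etale →
      MeasureTheory.volume (FPoint.coordImage A W f) = 0

/-- `A ⊆ S(ℂ)` is Lebesgue measurable: it agrees with a Borel set up to a null set. -/
def LebesgueMeasurable (A : Set (FPoint p φ)) : Prop :=
  ∃ B : Set (FPoint p φ), @MeasurableSet _ (borel (FPoint p φ)) B ∧ LebesgueNull (symmDiff A B)

end Lebesgue

end

/-!
The property `P(s)` enters the equivalence only through its invariance under differential
automorphisms of `U`: no analysis of strongly minimal sets is needed, and all six conditions are
compared with the behaviour of `P` at the generic points of `S`.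

*Generic points are conjugate.* If `s` and `s'` are generic points of `S` with constant coordinates,
then `k(s)` and `k(s')` are isomorphic over `k`, as differential fields with the zero derivation.
Such an isomorphism extends to a differential automorphism of `U`
(`exists_differential_automorphism`), and automorphisms preserve `P`
(`VectorFieldFamily.StronglyMinimalDisintegratedAt.of_automorphism`). The extension is built by
transfinite back-and-forth. Its single step (`exists_sameJets_option`) needs neither quantifier
elimination nor a prime differential ideal: to amalgamate two differential fields over a common
subfield, amalgamate the underlying fields in a field `F` and send both into the power series ring
`F⟦X⟧`, with derivation `d/dX`, by Taylor expansion; existential closedness and saturation then bring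
the new element back into `U`.

*Generic points are abundant.* Since `k` is countable, the generic points of `S(ℂ)` form a `G_δ` set
(`isGδ_isGeneric`). By Noether normalization an affine chart `B` of `S` is finite over a polynomial
ring in `d` variables, and the generic points of `B` lie over the tuples in `ℂ^d` that are
algebraically independent over `k`; almost all tuples are (`ae_algebraicIndependent`).
* In étale coordinates the non-generic points go to algebraically dependent tuples, so that they form
  a null set (`lebesgueNull_not_isGeneric`), whereas the generic points do not
  (`not_lebesgueNull_isGeneric`).
* The generic points are dense in the analytic topology: every point of `S(ℂ)` is a limit of generic
  points (`exists_injective_near`), by continuity of the roots of polynomials.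

Hence a set of positive measure contains a generic point, and so does a somewhere dense `G_δ` set, by
Baire's theorem in an affine chart (`exists_isGeneric_mem_of_isGδ`). Conversely the set of all generic
points has positive measure, and it is a dense `G_δ` set.
-/

/-! ### Extending derivations and Taylor expansions -/

/-- The extension of a derivation of a domain to its fraction field. It is read off from the ring
homomorphism `a ↦ a + ε D a` into the dual numbers over the fraction field. -/
theorem exists_derivation_fractionRing {A K : Type*} [CommRing A] [IsDomain A] [Field K]
    [Algebra A K] [IsFractionRing A K] (D : A →+ A) (hD : ∀ a b, D (a * b) = a * D b + b * D a) :
    ∃ E : Derivation ℤ K K, ∀ a, E (algebraMap A K a) = algebraMap A K (D a) := by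
  have hD1 : D 1 = 0 := by simpa using hD 1 1
  let g : A →+* TrivSqZeroExt K K :=
    { toFun a := TrivSqZeroExt.inl (algebraMap A K a) + TrivSqZeroExt.inr (algebraMap A K (D a))
      map_one' := by ext <;> simp [hD1]
      map_zero' := by ext <;> simp
      map_mul' a b := by
        ext
        · simp
        · simp only [TrivSqZeroExt.snd_add, TrivSqZeroExt.snd_inl, TrivSqZeroExt.snd_inr,
            TrivSqZeroExt.snd_mul, TrivSqZeroExt.fst_add, TrivSqZeroExt.fst_inl,
            TrivSqZeroExt.fst_inr, hD, smul_eq_mul, map_add, map_mul,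
            MulOpposite.smul_eq_mul_unop, MulOpposite.unop_op]
          ring
      map_add' a b := by
        ext
        · simp
        · simp only [TrivSqZeroExt.snd_add, TrivSqZeroExt.snd_inl, TrivSqZeroExt.snd_inr, map_add]
          ring }
  have hg : ∀ y : nonZeroDivisors A, IsUnit (g y) := fun y => by
    rw [TrivSqZeroExt.isUnit_iff_isUnit_fst]
    simp [g]
  let G : K →+* TrivSqZeroExt K K := IsLocalization.lift hg
  have hG : ∀ a, G (algebraMap A K a) = g a := fun a => IsLocalization.lift_eq hg a
  have hfst : ∀ x, (G x).fst = x := by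
    have : ((TrivSqZeroExt.fstHom K K K : TrivSqZeroExt K K →+* K).comp G) = RingHom.id K :=
      IsLocalization.ringHom_ext (nonZeroDivisors A) (by ext a; simp [hG, g])
    exact fun x => congrArg (fun f : K →+* K => f x) this
  refine ⟨Derivation.mk'
    (AddMonoidHom.mk' (fun x => (G x).snd) (by simp)).toIntLinearMap ?_, fun a => ?_⟩
  · intro a b
    change (G (a * b)).snd = a • (G b).snd + b • (G a).snd
    rw [map_mul, TrivSqZeroExt.snd_mul, hfst, hfst, MulOpposite.smul_eq_mul_unop,
      MulOpposite.unop_op, smul_eq_mul, smul_eq_mul, mul_comm b]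
  · change (G _).snd = _
    rw [hG]
    simp only [g, RingHom.coe_mk, MonoidHom.coe_mk, OneHom.coe_mk, TrivSqZeroExt.snd_add,
      TrivSqZeroExt.snd_inl, TrivSqZeroExt.snd_inr, zero_add]

open PowerSeries in
/-- The Taylor expansion `a ↦ ∑ e(a⁽ⁿ⁾) Xⁿ / n!` along a ring homomorphism `e` from a differential
ring to a field of characteristic zero. -/
noncomputable def taylorHom {A F : Type*} [CommRing A] [Differential A] [Field F] [CharZero F]
    (e : A →+* F) : A →+* PowerSeries F where
  toFun a := PowerSeries.mk fun n => (n.factorial : F)⁻¹ * e ((Differential.deriv : A → A)^[n] a)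
  map_one' := by
    ext n
    cases n with
    | zero => simp
    | succ n =>
      have : (Differential.deriv : A → A)^[n] 0 = 0 := Function.iterate_fixed (by simp) n
      simp [Function.iterate_succ, this, PowerSeries.coeff_one]
  map_zero' := by
    ext n
    simp
  map_add' a b := by
    ext n
    simp [iterate_map_add, mul_add]
  map_mul' := by
    have key : ∀ (n : ℕ) (a b : A),
        (n.factorial : F)⁻¹ * e ((Differential.deriv : A → A)^[n] (a * b)) =
        coeff n ((PowerSeries.mk fun n => (n.factorial : F)⁻¹ *
          e ((Differential.deriv : A → A)^[n] a)) * (PowerSeries.mk fun n =>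
          (n.factorial : F)⁻¹ * e ((Differential.deriv : A → A)^[n] b))) := by
      have hd : ∀ a : A, d⁄dX F (PowerSeries.mk fun n => (n.factorial : F)⁻¹ *
          e ((Differential.deriv : A → A)^[n] a)) = (PowerSeries.mk fun n =>
          (n.factorial : F)⁻¹ * e ((Differential.deriv : A → A)^[n] a′)) := fun a => by
        ext n
        have : (n.factorial : F) ≠ 0 := by exact_mod_cast n.factorial_ne_zero
        have : (n + 1 : F) ≠ 0 := by exact_mod_cast n.succ_ne_zero
        rw [PowerSeries.coeff_derivative, coeff_mk, coeff_mk, Nat.factorial_succ,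
          Function.iterate_succ_apply]
        push_cast
        field_simp
      intro n
      induction n with
      | zero => intro a b; simp
      | succ n ih =>
        intro a b
        have h1 : (n + 1 : F) ≠ 0 := by exact_mod_cast n.succ_ne_zero
        have h2 : (n.factorial : F) ≠ 0 := by exact_mod_cast n.factorial_ne_zero
        refine mul_right_cancel₀ h1 ?_
        rw [← PowerSeries.coeff_derivative, Derivation.leibniz, hd, hd, smul_eq_mul, smul_eq_mul,
          map_add, ← ih, ← ih, Function.iterate_succ_apply, Derivation.leibniz, smul_eq_mul,
          smul_eq_mul, iterate_map_add, map_add, Nat.factorial_succ]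
        push_cast
        field_simp
    intro a b
    ext n
    rw [coeff_mk, key]

open PowerSeries in
theorem derivative_taylorHom {A F : Type*} [CommRing A] [Differential A] [Field F] [CharZero F]
    (e : A →+* F) (a : A) : d⁄dX F (taylorHom e a) = taylorHom e a′ := by
  ext n
  have : (n.factorial : F) ≠ 0 := by exact_mod_cast n.factorial_ne_zero
  have : (n + 1 : F) ≠ 0 := by exact_mod_cast n.succ_ne_zero
  simp only [taylorHom, RingHom.coe_mk, MonoidHom.coe_mk, OneHom.coe_mk]
  rw [PowerSeries.coeff_derivative, coeff_mk, coeff_mk, Nat.factorial_succ,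
    Function.iterate_succ_apply]
  push_cast
  field_simp

/-! ### Jets and differential amalgamation -/

/-- Any two extensions of a field have a common extension, a residue field of their tensor
product. -/
theorem exists_field_amalgam {K M N : Type} [Field K] [Field M] [Field N] (f : K →+* M)
    (g : K →+* N) : ∃ (F : Type) (_ : Field F) (j₁ : M →+* F) (j₂ : N →+* F),
      j₁.comp f = j₂.comp g := by
  algebraize [f, g]
  obtain ⟨m, hm⟩ := Ideal.exists_maximal (TensorProduct K M N)
  refine ⟨_ ⧸ m, Ideal.Quotient.field m,
    (Ideal.Quotient.mk m).comp Algebra.TensorProduct.includeLeftRingHom,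
    (Ideal.Quotient.mk m).comp (Algebra.TensorProduct.includeRight : N →ₐ[K] _).toRingHom, ?_⟩
  ext x
  simp only [RingHom.comp_apply, AlgHom.toRingHom_eq_coe, RingHom.coe_coe]
  congr 1
  exact (Algebra.TensorProduct.includeLeft : M →ₐ[K] TensorProduct K M N).commutes x |>.trans
    ((Algebra.TensorProduct.includeRight : N →ₐ[K] TensorProduct K M N).commutes x).symm

/-- Two homomorphisms with the same kernel from a ring to fields become equal in a common
extension of these fields. -/
theorem exists_field_amalgam_of_ker_eq {R M N : Type} [CommRing R] [Field M] [Field N]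
    (f : R →+* M) (g : R →+* N) (h : RingHom.ker f = RingHom.ker g) :
    ∃ (F : Type) (_ : Field F) (j₁ : M →+* F) (j₂ : N →+* F), j₁.comp f = j₂.comp g := by
  have : (RingHom.ker f).IsPrime := RingHom.ker_isPrime f
  let f' : R ⧸ RingHom.ker f →+* M := RingHom.kerLift f
  let g' : R ⧸ RingHom.ker f →+* N := Ideal.Quotient.lift _ g fun a ha => by rwa [h] at ha
  have hf : Function.Injective f' := RingHom.kerLift_injective f
  have hg : Function.Injective g' :=
    RingHom.lift_injective_of_ker_le_ideal _ (fun a ha => by rwa [h] at ha) h.ge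
  obtain ⟨F, _, j₁, j₂, hj⟩ := exists_field_amalgam
    (IsFractionRing.lift hf : FractionRing (R ⧸ RingHom.ker f) →+* M) (IsFractionRing.lift hg)
  refine ⟨F, _, j₁, j₂, ?_⟩
  ext r
  have := congrArg (fun q => q (algebraMap (R ⧸ RingHom.ker f) _ (Ideal.Quotient.mk _ r))) hj
  simp only [RingHom.comp_apply, IsFractionRing.lift_algebraMap] at this
  exact this

/-- The value of a differential polynomial with integer coefficients at a family `v` of elements of
a differential ring; the variable `(i, n)` stands for the `n`-th derivative of the `i`-th
unknown. -/
noncomputable def jetEval {I K : Type*} [CommRing K] [Differential K] (v : I → K) :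
    MvPolynomial (I × ℕ) ℤ →+* K :=
  MvPolynomial.eval₂Hom (Int.castRingHom K) fun q => (Differential.deriv : K → K)^[q.2] (v q.1)

/-- Two families of elements of differential rings have the same jets if they satisfy the same
algebraic differential equations over `ℤ`. -/
def SameJets {I K L : Type*} [CommRing K] [Differential K] [CommRing L] [Differential L]
    (u : I → K) (v : I → L) : Prop :=
  ∀ p, jetEval u p = 0 ↔ jetEval v p = 0

theorem jetEval_comp {I K L : Type*} [CommRing K] [Differential K] [CommRing L] [Differential L]
    (e : K →+* L) (he : ∀ x, e x′ = (e x)′) (v : I → K) (p : MvPolynomial (I × ℕ) ℤ) :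
    jetEval (fun i => e (v i)) p = e (jetEval v p) := by
  have : jetEval (fun i => e (v i)) = e.comp (jetEval v) := by
    apply MvPolynomial.ringHom_ext
    · intro r; simp [jetEval]
    · rintro ⟨i, n⟩
      simp only [jetEval, MvPolynomial.eval₂Hom_X', RingHom.comp_apply]
      exact ((Function.Semiconj.iterate_right (f := e) (ga := (Differential.deriv : K → K))
        (gb := (Differential.deriv : L → L)) (fun x => he x) n) (v i)).symm
  rw [this]; rfl

/-- Differential amalgamation: if `u` and `v` have the same jets, then any `b` can be adjoined to
`v`, in an extension of the differential field, in the way in which it lies over `u`. The extension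
is the fraction field of a ring of power series over a field in which the two copies of the field
generated by the jets are amalgamated, without regard to derivations. -/
theorem exists_differential_amalgam {K I : Type} [Field K] [CharZero K] [Differential K]
    {u v : I → K} (h : SameJets u v) (b : K) :
    ∃ (L : Type) (_ : Field L) (_ : Differential L) (e : K →+* L) (c : L),
      (∀ x : K, e (x′) = (e x)′) ∧
      SameJets (fun o : Option I => o.elim b u) (fun o : Option I => o.elim c fun i => e (v i)) := by
  obtain ⟨F, _, j₁, j₂, hj⟩ := exists_field_amalgam_of_ker_eq (jetEval u) (jetEval v)
    (by ext p; exact h p)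
  have : CharZero F := charZero_of_injective_ringHom j₁.injective
  obtain ⟨E, hE⟩ := exists_derivation_fractionRing (K := FractionRing (PowerSeries F))
    (AddMonoidHom.mk' (PowerSeries.derivative F) (map_add _)) (PowerSeries.derivative F).leibniz
  let D : Differential (FractionRing (PowerSeries F)) := ⟨E⟩
  let T (j : K →+* F) : K →+* FractionRing (PowerSeries F) := (algebraMap _ _).comp (taylorHom j)
  have hT (j : K →+* F) (x : K) : T j (x′) = (T j x)′ := by
    change _ = E _
    simp only [T, RingHom.comp_apply, hE, ← derivative_taylorHom]
    rfl
  refine ⟨FractionRing (PowerSeries F), inferInstance, D, T j₂, T j₁ b, hT j₂, fun p => ?_⟩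
  have hv : (fun o : Option I => o.elim (T j₁ b) fun i => T j₂ (v i)) =
      fun o : Option I => T j₁ (o.elim b u) := by
    funext o
    cases o with
    | none => rfl
    | some i =>
      simp only [Option.elim_some, T, RingHom.comp_apply]
      congr 1
      ext n
      have := congrArg (fun q => q (MvPolynomial.X (i, n))) hj
      simp only [RingHom.comp_apply, jetEval, MvPolynomial.eval₂Hom_X'] at this
      simp [taylorHom, this]
  rw [hv, jetEval_comp _ (hT j₁), map_eq_zero_iff _ (T j₁).injective]

/-! ### One-step extensions in saturated models -/

section Realize

open FirstOrder.Language

variable {I K : Type*} [CommRing K] [Differential K] (v : I → K) (t s : diffRingLang.Term I)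

theorem realize_zero : (Term.func (L := diffRingLang) DiffRingFunc.zero ![]).realize v = 0 := rfl

theorem realize_one : (Term.func (L := diffRingLang) DiffRingFunc.one ![]).realize v = 1 := rfl

theorem realize_neg :
    (Term.func (L := diffRingLang) DiffRingFunc.neg ![t]).realize v = -t.realize v := rfl

theorem realize_deriv :
    (Term.func (L := diffRingLang) DiffRingFunc.deriv ![t]).realize v = (t.realize v)′ := rfl

theorem realize_add : (Term.func (L := diffRingLang) DiffRingFunc.add ![t, s]).realize v =
    t.realize v + s.realize v := rfl

theorem realize_mul : (Term.func (L := diffRingLang) DiffRingFunc.mul ![t, s]).realize v =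
    t.realize v * s.realize v := rfl

end Realize

/-- Differential polynomials are terms of the language of differential rings. -/
theorem exists_term_jetEval {I : Type} (p : MvPolynomial (I × ℕ) ℤ) :
    ∃ t : diffRingLang.Term I, ∀ (K : Type) [CommRing K] [Differential K] (v : I → K),
      t.realize v = jetEval v p := by
  have hint : ∀ z : ℤ, ∃ t : diffRingLang.Term I,
      ∀ (K : Type) [CommRing K] [Differential K] (v : I → K), t.realize v = z := by
    intro z
    induction z with
    | zero => exact ⟨.func DiffRingFunc.zero ![], fun K _ _ v => by
        simp [realize_zero]⟩
    | succ n ih =>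
      obtain ⟨t, ht⟩ := ih
      exact ⟨.func DiffRingFunc.add ![t, .func DiffRingFunc.one ![]], fun K _ _ v => by
        simp [realize_add, realize_one, ht]⟩
    | pred n ih =>
      obtain ⟨t, ht⟩ := ih
      exact ⟨.func DiffRingFunc.add ![t, .func DiffRingFunc.neg
        ![.func DiffRingFunc.one ![]]], fun K _ _ v => by
        simp [realize_add, realize_neg, realize_one, ht, sub_eq_add_neg]⟩
  induction p using MvPolynomial.induction_on with
  | C z =>
    obtain ⟨t, ht⟩ := hint z
    exact ⟨t, fun K _ _ v => by simp [ht, jetEval]⟩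
  | add p q hp hq =>
    obtain ⟨t, ht⟩ := hp
    obtain ⟨s, hs⟩ := hq
    exact ⟨.func DiffRingFunc.add ![t, s], fun K _ _ v => by
      simp [realize_add, ht, hs]⟩
  | mul_X p i hp =>
    obtain ⟨t, ht⟩ := hp
    obtain ⟨i, n⟩ := i
    have : ∃ s : diffRingLang.Term I, ∀ (K : Type) [CommRing K] [Differential K] (v : I → K),
        s.realize v = (Differential.deriv : K → K)^[n] (v i) := by
      induction n with
      | zero => exact ⟨.var i, fun K _ _ v => rfl⟩
      | succ n ih =>
        obtain ⟨s, hs⟩ := ih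
        exact ⟨.func DiffRingFunc.deriv ![s], fun K _ _ v => by
          simp [realize_deriv, hs, Function.iterate_succ_apply']⟩
    obtain ⟨s, hs⟩ := this
    exact ⟨.func DiffRingFunc.mul ![t, s], fun K _ _ v => by
      simp [realize_mul, ht, hs, jetEval]⟩

/-- The vanishing of a differential polynomial is an atomic condition. -/
theorem exists_formula_jetEval {I : Type} (p : MvPolynomial (I × ℕ) ℤ) :
    ∃ φ : diffRingLang.Formula I, φ.IsQF ∧
      ∀ (K : Type) [CommRing K] [Differential K] (v : I → K),
        φ.Realize v ↔ jetEval v p = 0 := by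
  obtain ⟨t, ht⟩ := exists_term_jetEval p
  obtain ⟨s, hs⟩ := exists_term_jetEval (0 : MvPolynomial (I × ℕ) ℤ)
  refine ⟨t.equal s, (FirstOrder.Language.BoundedFormula.IsAtomic.equal _ _).isQF,
    fun K _ _ v => ?_⟩
  rw [FirstOrder.Language.Formula.realize_equal, ht, hs, map_zero]

/-- A finite part of the type of `b` over the jets of `u` is expressed by a quantifier-free
formula. -/
theorem exists_formula_jetEval_finset {I : Type} (s : Finset (MvPolynomial (I × ℕ) ℤ))
    (P : MvPolynomial (I × ℕ) ℤ → Prop) :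
    ∃ φ : diffRingLang.Formula I, φ.IsQF ∧
      ∀ (K : Type) [CommRing K] [Differential K] (v : I → K),
        φ.Realize v ↔ ∀ p ∈ s, (P p ↔ jetEval v p = 0) := by
  classical
  induction s using Finset.induction_on with
  | empty => exact ⟨⊤, .top, fun K _ _ v => by simp⟩
  | insert p s hp ih =>
    obtain ⟨φ, hφ, hφ'⟩ := ih
    obtain ⟨ψ, hψ, hψ'⟩ := exists_formula_jetEval p
    by_cases hP : P p
    · refine ⟨φ ⊓ ψ, hφ.inf hψ, fun K _ _ v => ?_⟩
      rw [FirstOrder.Language.Formula.realize_inf, hφ', hψ']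
      simp [hP, and_comm]
    · refine ⟨φ ⊓ ψ.not, hφ.inf hψ.not, fun K _ _ v => ?_⟩
      rw [FirstOrder.Language.Formula.realize_inf, FirstOrder.Language.Formula.realize_not, hφ',
        hψ']
      simp [hP, and_comm]

/-- Homogeneity of saturated differentially closed fields, for one new element. -/
theorem exists_sameJets_option {K : Type} [Field K] [Differential K]
    (hK : IsDifferentiallyClosed K) (hsat : IsSaturatedModel diffRingLang K) {I : Type}
    (hI : Cardinal.mk I < Cardinal.mk K) {u v : I → K} (h : SameJets u v) (b : K) :
    ∃ c : K, SameJets (fun o : Option I => o.elim b u) (fun o : Option I => o.elim c v) := by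
  classical
  have := hK.1
  let E (p : MvPolynomial (Option I × ℕ) ℤ) : Set K :=
    {c | jetEval (fun o : Option I => o.elim b u) p = 0 ↔
      jetEval (fun o : Option I => o.elim c v) p = 0}
  suffices (⋂₀ (Set.range E)).Nonempty by
    obtain ⟨c, hc⟩ := this
    exact ⟨c, fun p => hc _ ⟨p, rfl⟩⟩
  refine hsat (Set.range v) (Cardinal.mk_range_le.trans_lt hI) _ ?_ fun G hG => ?_
  · rintro _ ⟨p, rfl⟩
    obtain ⟨φ, -, hφ⟩ := exists_formula_jetEval_finset {p}
      fun p => jetEval (fun o : Option I => o.elim b u) p = 0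
    rw [Set.Definable₁, Set.definable_iff_exists_formula_sum]
    refine ⟨φ.relabel fun o => o.elim (Sum.inr 0) fun i => Sum.inl ⟨v i, i, rfl⟩, ?_⟩
    ext x
    have : (fun o : Option I => o.elim (x 0) v) = Sum.elim (↑) x ∘ fun o : Option I =>
        o.elim (Sum.inr 0) fun i => Sum.inl (⟨v i, i, rfl⟩ : Set.range v) := by
      funext o; cases o <;> rfl
    refine Iff.trans ?_ (FirstOrder.Language.Formula.realize_relabel).symm
    rw [← this, hφ]
    simp [E]
  · obtain ⟨s, rfl⟩ : ∃ s : Finset (MvPolynomial (Option I × ℕ) ℤ), G = s.image E := by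
      obtain ⟨s, -, hs⟩ := Finset.subset_set_image_iff.1 (by rwa [Set.image_univ] : _ ⊆ E '' Set.univ)
      exact ⟨s, hs.symm⟩
    obtain ⟨φ, hqf, hφ⟩ := exists_formula_jetEval_finset s
      fun p => jetEval (fun o : Option I => o.elim b u) p = 0
    obtain ⟨L, _, _, e, c, he, hc⟩ := exists_differential_amalgam h b
    let ρ : Option I → K ⊕ Fin 1 := fun o => o.elim (Sum.inr 0) fun i => Sum.inl (v i)
    have hρ (L' : Type) (e' : K → L') (y : Fin 1 → L') : Sum.elim (fun a => e' a) y ∘ ρ =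
        fun o : Option I => o.elim (y 0) fun i => e' (v i) := by
      funext o; cases o <;> rfl
    obtain ⟨y, hy⟩ := hK.2 L e he 1 (φ.relabel ρ) (hqf.relabel _) ⟨fun _ => c, by
      rw [FirstOrder.Language.Formula.realize_relabel, hρ, hφ]
      exact fun p _ => hc p⟩
    rw [FirstOrder.Language.Formula.realize_relabel, hφ] at hy
    refine ⟨y 0, ?_⟩
    rintro _ hE
    obtain ⟨p, hp, rfl⟩ := Finset.mem_image.1 hE
    have := hy p hp
    rw [show (Sum.elim id y ∘ ρ) = _ from hρ K id y] at this
    exact this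

/-! ### Back and forth -/

/-- Transfinite back-and-forth on an uncountable type `α`: a countable relation with a property
`Good` of finite character extends to a good relation which is total on both sides, provided that
good relations of cardinality less than that of `α` can be extended to any given element. -/
theorem exists_total_of_extension {α : Type} (hα : Cardinal.aleph0 < Cardinal.mk α)
    (Good : Set (α × α) → Prop)
    (hfin : ∀ R, (∀ T ⊆ R, T.Finite → Good T) → Good R) (hmono : ∀ R T, T ⊆ R → Good R → Good T)
    (hext : ∀ R, Good R → Cardinal.mk R < Cardinal.mk α → ∀ a, ∃ T : Set (α × α), T.Finite ∧
      Good (R ∪ T) ∧ a ∈ Prod.fst '' T ∧ a ∈ Prod.snd '' T)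
    (R₀ : Set (α × α)) (h₀ : Good R₀) (hc : R₀.Countable) :
    ∃ R, R₀ ⊆ R ∧ Good R ∧ (∀ a, ∃ b, (a, b) ∈ R) ∧ (∀ b, ∃ a, (a, b) ∈ R) := by
  classical
  obtain ⟨r, hwo, hr⟩ := Cardinal.exists_ord_eq α
  -- `F a` is the finite set of pairs added at stage `a`
  let step (a : α) (ih : ∀ b, r b a → Set (α × α)) : Set (α × α) :=
    if h : ∃ T : Set (α × α), T.Finite ∧ Good ((R₀ ∪ ⋃ b, ⋃ h : r b a, ih b h) ∪ T) ∧
      a ∈ Prod.fst '' T ∧ a ∈ Prod.snd '' T then h.choose else ∅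
  let F : α → Set (α × α) := (IsWellFounded.wf (r := r)).fix step
  let B (a : α) : Set (α × α) := R₀ ∪ ⋃ b, ⋃ _ : r b a, F b
  have hF (a : α) : F a = if h : ∃ T : Set (α × α), T.Finite ∧ Good (B a ∪ T) ∧
      a ∈ Prod.fst '' T ∧ a ∈ Prod.snd '' T then h.choose else ∅ := by
    simp only [F]
    rw [WellFounded.fix_eq]
  have hFfin (a : α) : (F a).Finite := by
    rw [hF]
    split_ifs with h
    · exact h.choose_spec.1
    · exact Set.finite_empty
  have hcard (a : α) : Cardinal.mk (B a) < Cardinal.mk α := by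
    have h1 : Cardinal.mk {b // r b a} < Cardinal.mk α := by
      have := Cardinal.card_typein_lt a hr
      rwa [Ordinal.card_typein] at this
    have h2 : (⋃ b, ⋃ _ : r b a, F b) = ⋃ b : {b // r b a}, F b := by
      ext; simp
    refine (Cardinal.mk_union_le _ _).trans_lt (Cardinal.add_lt_of_lt hα.le
      (hc.le_aleph0.trans_lt hα) ?_)
    rw [h2]
    refine (Cardinal.mk_iUnion_le _).trans_lt (Cardinal.mul_lt_of_lt hα.le h1 ?_)
    refine (ciSup_le' fun b => ?_).trans_lt hα
    exact (hFfin b).countable.le_aleph0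
  -- the union of the stages in an initial segment is good if each of these stages is
  have hunion (J : Set α) (hJ : ∀ a ∈ J, Good (B a ∪ F a)) : Good (R₀ ∪ ⋃ a ∈ J, F a) := by
    refine hfin _ fun T hT hTfin => ?_
    let c : Set (Set (α × α)) := insert R₀ ((fun a => B a ∪ F a) '' J)
    have hdir : DirectedOn (· ⊆ ·) c := by
      have hR (a) : R₀ ⊆ B a ∪ F a := Set.subset_union_left.trans Set.subset_union_left
      have hlt (a b) (h : r a b) : B a ∪ F a ⊆ B b ∪ F b := by
        refine Set.union_subset (Set.union_subset (hR b) ?_) ?_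
        · exact Set.iUnion₂_subset fun d hd x hx =>
            Or.inl (Or.inr (Set.mem_iUnion₂.2 ⟨d, _root_.trans hd h, hx⟩))
        · exact fun x hx => Or.inl (Or.inr (Set.mem_iUnion₂.2 ⟨a, h, hx⟩))
      refine IsChain.directedOn ?_
      refine IsChain.insert ?_ ?_
      · rintro _ ⟨a, ha, rfl⟩ _ ⟨b, hb, rfl⟩ -
        rcases trichotomous_of r a b with h | rfl | h
        · exact Or.inl (hlt _ _ h)
        · exact Or.inl subset_rfl
        · exact Or.inr (hlt _ _ h)
      · rintro _ ⟨a, ha, rfl⟩ -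
        exact Or.inl (hR a)
    obtain ⟨X, hX, hTX⟩ := hdir.exists_mem_subset_of_finite_of_subset_sUnion
      ⟨_, Set.mem_insert _ _⟩ hTfin (s := T) (by
        refine hT.trans (Set.union_subset ?_ (Set.iUnion₂_subset fun a ha => ?_))
        · exact Set.subset_sUnion_of_mem (Set.mem_insert _ _)
        · exact Set.subset_union_right.trans (Set.subset_sUnion_of_mem
            (Set.mem_insert_of_mem _ ⟨a, ha, rfl⟩)))
    rcases hX with rfl | ⟨a, ha, rfl⟩
    · exact hmono _ _ hTX h₀
    · exact hmono _ _ hTX (hJ a ha)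
  have hgood (a : α) : Good (B a ∪ F a) ∧ a ∈ Prod.fst '' F a ∧ a ∈ Prod.snd '' F a := by
    induction a using (IsWellFounded.wf (r := r)).induction with
    | _ a ih =>
      have hB : Good (B a) := hunion {b | r b a} fun b hb => (ih b hb).1
      have := hext (B a) hB (hcard a) a
      rw [hF, dif_pos this]
      exact this.choose_spec.2
  refine ⟨R₀ ∪ ⋃ a ∈ Set.univ, F a, Set.subset_union_left, hunion _ fun a _ => (hgood a).1,
    fun a => ?_, fun a => ?_⟩
  · obtain ⟨⟨x, y⟩, h, rfl⟩ := (hgood a).2.1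
    exact ⟨y, Or.inr (Set.mem_biUnion (Set.mem_univ _) h)⟩
  · obtain ⟨⟨x, y⟩, h, rfl⟩ := (hgood a).2.2
    exact ⟨x, Or.inr (Set.mem_biUnion (Set.mem_univ _) h)⟩

theorem jetEval_rename {I J K : Type*} [CommRing K] [Differential K] (f : J → I) (v : I → K)
    (p : MvPolynomial (J × ℕ) ℤ) :
    jetEval v (MvPolynomial.rename (Prod.map f id) p) = jetEval (v ∘ f) p := by
  simp only [jetEval, MvPolynomial.coe_eval₂Hom, MvPolynomial.eval₂_rename]
  rfl

theorem SameJets.comp {I J K L : Type*} [CommRing K] [Differential K] [CommRing L]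
    [Differential L] {u : I → K} {v : I → L} (h : SameJets u v) (f : J → I) :
    SameJets (u ∘ f) (v ∘ f) := fun p => by
  rw [← jetEval_rename, ← jetEval_rename]
  exact h _

/-- A binary relation on a differential ring is jet-preserving if corresponding elements satisfy
the same algebraic differential equations over `ℤ`. -/
def JetPreserving {K : Type} [CommRing K] [Differential K] (R : Set (K × K)) : Prop :=
  SameJets (fun r : R => r.1.1) (fun r : R => r.1.2)

section JetPreserving

variable {K : Type} [Field K] [Differential K]

theorem JetPreserving.mono {R T : Set (K × K)} (h : JetPreserving R) (hT : T ⊆ R) :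
    JetPreserving T :=
  SameJets.comp h (Set.inclusion hT)

theorem jetPreserving_of_finite {R : Set (K × K)}
    (h : ∀ T ⊆ R, T.Finite → JetPreserving T) : JetPreserving R := by
  classical
  intro p
  let T : Set (K × K) := Subtype.val '' (Prod.fst '' (p.vars : Set (R × ℕ)))
  have hTR : T ⊆ R := by rintro _ ⟨x, -, rfl⟩; exact x.2
  obtain ⟨q, hq⟩ := MvPolynomial.exists_rename_eq_of_vars_subset_range p
    (Prod.map (Set.inclusion hTR) (id : ℕ → ℕ))
    (Function.Injective.prodMap (Set.inclusion_injective hTR) Function.injective_id) (by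
      rintro ⟨x, n⟩ hx
      exact ⟨(⟨x.1, x, ⟨_, hx, rfl⟩, rfl⟩, n), rfl⟩)
  rw [← hq, jetEval_rename, jetEval_rename]
  exact h T hTR ((p.vars.finite_toSet.image _).image _) q

theorem JetPreserving.swap {R : Set (K × K)} (h : JetPreserving R) :
    JetPreserving (Prod.swap '' R) := by
  have := SameJets.comp (J := (Prod.swap '' R : Set (K × K))) h
    (fun x => ⟨x.1.swap, by obtain ⟨_, y, hy, rfl⟩ := x; simpa using hy⟩)
  exact fun p => (this p).symm

theorem JetPreserving.exists_insert (hK : IsDifferentiallyClosed K)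
    (hsat : IsSaturatedModel diffRingLang K) {R : Set (K × K)} (h : JetPreserving R)
    (hR : Cardinal.mk R < Cardinal.mk K) (a : K) : ∃ b, JetPreserving (insert (a, b) R) := by
  classical
  obtain ⟨b, hb⟩ := exists_sameJets_option hK hsat hR h a
  refine ⟨b, ?_⟩
  have := hb.comp (J := (insert (a, b) R : Set (K × K)))
    (fun x => if hx : x.1 ∈ R then some ⟨x.1, hx⟩ else none)
  unfold JetPreserving
  convert this using 1
  · funext ⟨x, hx⟩
    by_cases h : x ∈ R
    · simp [h]
    · obtain rfl : x = (a, b) := hx.resolve_right h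
      simp [h]
  · funext ⟨x, hx⟩
    by_cases h : x ∈ R
    · simp [h]
    · obtain rfl : x = (a, b) := hx.resolve_right h
      simp [h]

/-- A jet-preserving relation that is total on both sides is the graph of a differential
automorphism. -/
theorem JetPreserving.exists_ringEquiv {R : Set (K × K)} (h : JetPreserving R)
    (h₁ : ∀ a, ∃ b, (a, b) ∈ R) (h₂ : ∀ b, ∃ a, (a, b) ∈ R) :
    ∃ σ : K ≃+* K, (∀ x, σ x′ = (σ x)′) ∧ ∀ r ∈ R, σ r.1 = r.2 := by
  choose f hf using h₁
  choose g hg using h₂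
  have hX (r : R) (n : ℕ) : jetEval (fun r : R => r.1.1) (MvPolynomial.X (r, n)) =
      (Differential.deriv : K → K)^[n] r.1.1 := by simp [jetEval]
  have hY (r : R) (n : ℕ) : jetEval (fun r : R => r.1.2) (MvPolynomial.X (r, n)) =
      (Differential.deriv : K → K)^[n] r.1.2 := by simp [jetEval]
  have heq (r s : R) : r.1.1 = s.1.1 ↔ r.1.2 = s.1.2 := by
    have := h (.X (r, 0) - .X (s, 0))
    simpa only [map_sub, hX, hY, sub_eq_zero, Function.iterate_zero, id] using this
  have hr (r : R) : f r.1.1 = r.1.2 := (heq ⟨_, hf r.1.1⟩ r).1 rfl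
  let F (x : K) : R := ⟨_, hf x⟩
  let σ : K →+* K :=
    { toFun := f
      map_one' := by
        have := (h (.X (F 1, 0) - 1)).1
        simpa only [map_sub, hX, hY, map_one, sub_self, sub_eq_zero, Function.iterate_zero, id,
          F, forall_const] using this
      map_zero' := by
        have := (h (.X (F 0, 0))).1
        simpa only [hX, hY, Function.iterate_zero, id, F, forall_const] using this
      map_mul' a b := by
        have := (h (.X (F (a * b), 0) - .X (F a, 0) * .X (F b, 0))).1
        simpa only [map_sub, map_mul, hX, hY, sub_self, sub_eq_zero, Function.iterate_zero, id, F,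
          forall_const] using this
      map_add' a b := by
        have := (h (.X (F (a + b), 0) - (.X (F a, 0) + .X (F b, 0)))).1
        simpa only [map_sub, map_add, hX, hY, sub_self, sub_eq_zero, Function.iterate_zero, id, F,
          forall_const] using this }
  have hσ : Function.Bijective σ := ⟨σ.injective, fun b => ⟨g b, hr ⟨_, hg b⟩⟩⟩
  refine ⟨RingEquiv.ofBijective σ hσ, fun x => ?_, fun r hx => hr ⟨r, hx⟩⟩
  change f _ = Differential.deriv (f _)
  have := (h (.X (F x′, 0) - .X (F x, 1))).1
  simpa only [map_sub, hX, hY, sub_self, sub_eq_zero, Function.iterate_zero, Function.iterate_one,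
    id, F, forall_const] using this

/-- Homogeneity of uncountable saturated differentially closed fields. -/
theorem exists_differential_automorphism (hK : IsDifferentiallyClosed K)
    (hsat : IsSaturatedModel diffRingLang K) (hunc : Cardinal.aleph0 < Cardinal.mk K)
    {R₀ : Set (K × K)} (h : JetPreserving R₀) (hc : R₀.Countable) :
    ∃ σ : K ≃+* K, (∀ x, σ x′ = (σ x)′) ∧ ∀ r ∈ R₀, σ r.1 = r.2 := by
  obtain ⟨R, hR, hgood, h₁, h₂⟩ := exists_total_of_extension hunc JetPreserving
    (fun R h => jetPreserving_of_finite h) (fun R T hT h => h.mono hT)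
    (fun R hR hcard a => by
      obtain ⟨b, hb⟩ := hR.exists_insert hK hsat hcard a
      have hcard' : Cardinal.mk (Prod.swap '' insert (a, b) R : Set (K × K)) <
          Cardinal.mk K := by
        refine (Cardinal.mk_image_le.trans Cardinal.mk_insert_le).trans_lt ?_
        exact Cardinal.add_lt_of_lt hunc.le hcard (Cardinal.one_lt_aleph0.trans hunc)
      obtain ⟨d, hd⟩ := hb.swap.exists_insert hK hsat hcard' a
      refine ⟨{(a, b), (d, a)}, by simp, ?_, by simp, by simp⟩
      refine hd.swap.mono ?_
      rintro x (hx | rfl | rfl)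
      · exact ⟨x.swap, Or.inr ⟨x, Or.inr hx, rfl⟩, by simp⟩
      · exact ⟨(b, a), Or.inr ⟨(a, b), Or.inl rfl, rfl⟩, rfl⟩
      · exact ⟨(a, d), Or.inl rfl, rfl⟩) R₀ h hc
  obtain ⟨σ, hσ, hσR⟩ := hgood.exists_ringEquiv h₁ h₂
  exact ⟨σ, hσ, fun r hr => hσR r (hR hr)⟩

/-- Two embeddings of a ring into the field of constants are related by an automorphism. -/
theorem exists_automorphism_of_constants (hK : IsDifferentiallyClosed K)
    (hsat : IsSaturatedModel diffRingLang K) (hunc : Cardinal.aleph0 < Cardinal.mk K)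
    {B : Type} [CommRing B] [Countable B] (f g : B →+* K) (hf : Function.Injective f)
    (hg : Function.Injective g) (hf' : ∀ b, (f b)′ = 0) (hg' : ∀ b, (g b)′ = 0) :
    ∃ σ : K ≃+* K, (∀ x, σ x′ = (σ x)′) ∧ ∀ b, σ (f b) = g b := by
  let R₀ : Set (K × K) := Set.range fun b => (f b, g b)
  have key (e : B →+* K) (he : ∀ b, (e b)′ = 0) (v : R₀ → B) (p) :
      jetEval (fun r => e (v r)) p =
        e (MvPolynomial.eval₂Hom (Int.castRingHom B) (fun q : R₀ × ℕ =>
          if q.2 = 0 then v q.1 else 0) p) := by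
    suffices jetEval (fun r => e (v r)) = e.comp (MvPolynomial.eval₂Hom (Int.castRingHom B)
      (fun q : R₀ × ℕ => if q.2 = 0 then v q.1 else 0)) by rw [this]; rfl
    apply MvPolynomial.ringHom_ext
    · intro z; simp [jetEval]
    · rintro ⟨r, n⟩
      simp only [jetEval, MvPolynomial.eval₂Hom_X', RingHom.comp_apply]
      cases n with
      | zero => simp
      | succ n =>
        rw [Function.iterate_succ_apply, he]
        simp
  have hR₀ : JetPreserving R₀ := by
    choose v hv using fun r : R₀ => r.2
    have h1 : (fun r : R₀ => r.1.1) = fun r => f (v r) := by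
      funext r; exact (congrArg Prod.fst (hv r)).symm
    have h2 : (fun r : R₀ => r.1.2) = fun r => g (v r) := by
      funext r; exact (congrArg Prod.snd (hv r)).symm
    intro p
    rw [h1, h2, key f hf', key g hg', map_eq_zero_iff f hf, map_eq_zero_iff g hg]
  obtain ⟨σ, hσ, h⟩ := exists_differential_automorphism hK hsat hunc hR₀ (Set.countable_range _)
  exact ⟨σ, hσ, fun b => h _ ⟨b, rfl⟩⟩

end JetPreserving

/-! ### Points of schemes with values in a field -/

theorem AlgebraicGeometry.Scheme.exists_isAffineOpen_mem {S : Scheme.{0}} (s : S) :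
    ∃ V : S.Opens, IsAffineOpen V ∧ s ∈ V := by
  obtain ⟨_, ⟨V, hV, rfl⟩, hsV, -⟩ := S.isBasis_affineOpens.exists_subset_of_mem_open
    (Set.mem_univ s) isOpen_univ
  exact ⟨V, hV, hsV⟩

namespace FPoint

variable {k : Type} [Field k] {X : Scheme.{0}} {p : X ⟶ Spec (.of k)}
  {F : Type} [Field F] {φ : k →+* F}

theorem preimage_eq_top (x : FPoint p φ) {V : X.Opens} (h : x.pt ∈ V) : x.1 ⁻¹ᵁ V = ⊤ :=
  Scheme.preimage_eq_top_of_closedPoint_mem x.1 h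

/-- Evaluation of regular functions at a point `x : Spec F ⟶ X` is pulling back along `x`. -/
theorem ofHom_eval (x : FPoint p φ) (V : X.Opens) (h : x.pt ∈ V) :
    CommRingCat.ofHom (x.eval V h) =
      x.1.appLE V ⊤ (x.preimage_eq_top h).ge ≫ (Scheme.ΓSpecIso (.of F)).hom := by
  have := Scheme.germ_stalkClosedPointTo x.1 V h
  refine Eq.trans (b := X.presheaf.germ V _ h ≫ Scheme.stalkClosedPointTo x.1) rfl (this.trans ?_)
  simp only [Iso.trans_hom, Functor.mapIso_hom, Iso.op_hom, Scheme.Hom.app_eq_appLE,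
    Scheme.Hom.appLE_map_assoc]

theorem specMap_eval_fromSpec (x : FPoint p φ) {V : X.Opens} (hV : IsAffineOpen V)
    (h : x.pt ∈ V) : Spec.map (CommRingCat.ofHom (x.eval V h)) ≫ hV.fromSpec = x.1 := by
  rw [ofHom_eval]
  have := IsAffineOpen.SpecMap_appLE_fromSpec x.1 hV (isAffineOpen_top _)
    (x.preimage_eq_top h).ge
  rw [IsAffineOpen.fromSpec_top, Iso.eq_inv_comp, Scheme.isoSpec_Spec_hom] at this
  simpa only [Spec.map_comp, Category.assoc] using this

theorem ext_of_eval {x y : FPoint p φ} {V : X.Opens} (hV : IsAffineOpen V) (hx : x.pt ∈ V)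
    (hy : y.pt ∈ V) (h : x.eval V hx = y.eval V hy) : x = y :=
  Subtype.ext (by rw [← x.specMap_eval_fromSpec hV hx, ← y.specMap_eval_fromSpec hV hy, h])

theorem eval_res (x : FPoint p φ) {V W : X.Opens} (i : W ≤ V) (h : x.pt ∈ W) (f : Γ(X, V)) :
    x.eval W h (X.presheaf.map (homOfLE i).op f) = x.eval V (i h) f := by
  simp only [eval, RingHom.comp_apply]
  congr 1
  exact X.presheaf.germ_res_apply (homOfLE i) _ h f

theorem eval_scalarHom (x : FPoint p φ) (V : X.Opens) (h : x.pt ∈ V) (c : k) :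
    x.eval V h (scalarHom p V c) = φ c := by
  have key (f : Spec (.of F) ⟶ X) (hf : f ≫ p = Spec.map (CommRingCat.ofHom φ))
      (e : ⊤ ≤ f ⁻¹ᵁ V) (e' : V ≤ p ⁻¹ᵁ ⊤) : (Scheme.ΓSpecIso (.of k)).inv ≫ p.appLE ⊤ V e' ≫
        f.appLE V ⊤ e ≫ (Scheme.ΓSpecIso (.of F)).hom = CommRingCat.ofHom φ := by
    rw [Scheme.Hom.appLE_comp_appLE_assoc, Iso.inv_comp_eq, ← Scheme.ΓSpecIso_naturality,
      Scheme.Hom.appTop, Scheme.Hom.app_eq_appLE]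
    simp only [hf]
    rfl
  have h1 : CommRingCat.ofHom ((x.eval V h).comp (scalarHom p V)) = CommRingCat.ofHom φ := by
    rw [CommRingCat.ofHom_comp, ofHom_eval]
    exact key x.1 x.2 (x.preimage_eq_top h).ge (by simp)
  exact congrArg (fun q => q.hom c) h1

theorem mem_basicOpen_iff (x : FPoint p φ) {V : X.Opens} (h : x.pt ∈ V) (f : Γ(X, V)) :
    x.pt ∈ X.basicOpen f ↔ x.eval V h f ≠ 0 := by
  have : IsLocalHom x.stalkHom := Scheme.isLocalHom_stalkClosedPointTo' x.1
  rw [Scheme.mem_basicOpen _ _ _ h, ← isUnit_iff_ne_zero]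
  exact (isUnit_map_iff x.stalkHom _).symm

theorem mem_field_iff (x : FPoint p φ) (c : F) :
    c ∈ x.field ↔ ∃ (V : X.Opens) (h : x.pt ∈ V) (f : Γ(X, V)), x.eval V h f = c := by
  constructor
  · rintro ⟨a, rfl⟩
    obtain ⟨V, h, f, rfl⟩ := X.presheaf.exists_germ_eq a
    exact ⟨V, h, f, rfl⟩
  · rintro ⟨V, h, f, rfl⟩
    exact ⟨_, rfl⟩

section BaseChange

variable {F' : Type} [Field F'] {φ' : k →+* F'} {x : FPoint p φ} {y : FPoint p φ'} {ψ : F →+* F'}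

theorem pt_eq_of_specMap (h : y.1 = Spec.map (CommRingCat.ofHom ψ) ≫ x.1) : y.pt = x.pt := by
  rw [pt, h]
  exact congrArg x.1 (IsLocalRing.comap_closedPoint ψ)

theorem eval_of_specMap (h : y.1 = Spec.map (CommRingCat.ofHom ψ) ≫ x.1) {V : X.Opens}
    (hy : y.pt ∈ V) (hx : x.pt ∈ V) (f : Γ(X, V)) : y.eval V hy f = ψ (x.eval V hx f) := by
  have key (f : Spec (.of F) ⟶ X) (e e') :
      (Spec.map (CommRingCat.ofHom ψ) ≫ f).appLE V ⊤ e' ≫ (Scheme.ΓSpecIso (.of F')).hom =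
      f.appLE V ⊤ e ≫ (Scheme.ΓSpecIso (.of F)).hom ≫ CommRingCat.ofHom ψ := by
    have htop : ⊤ ≤ Spec.map (CommRingCat.ofHom ψ) ⁻¹ᵁ ⊤ := le_rfl
    have hnat : (Spec.map (CommRingCat.ofHom ψ)).appLE ⊤ ⊤ htop ≫
        (Scheme.ΓSpecIso (.of F')).hom =
        (Scheme.ΓSpecIso (.of F)).hom ≫ CommRingCat.ofHom ψ := by
      rw [← Scheme.ΓSpecIso_naturality, Scheme.Hom.appTop, Scheme.Hom.app_eq_appLE]
      rfl
    rw [← hnat, Scheme.Hom.appLE_comp_appLE_assoc]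
  have : CommRingCat.ofHom (y.eval V hy) = CommRingCat.ofHom (ψ.comp (x.eval V hx)) := by
    rw [CommRingCat.ofHom_comp, ofHom_eval, ofHom_eval]
    simp only [h, Category.assoc]
    exact key x.1 _ _
  exact congrArg (fun q => q.hom f) this

theorem specMap_of_eval {V : X.Opens} (hV : IsAffineOpen V) (hy : y.pt ∈ V) (hx : x.pt ∈ V)
    (h : ∀ f, y.eval V hy f = ψ (x.eval V hx f)) :
    y.1 = Spec.map (CommRingCat.ofHom ψ) ≫ x.1 := by
  rw [← y.specMap_eval_fromSpec hV hy, ← x.specMap_eval_fromSpec hV hx, ← Spec.map_comp_assoc,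
    ← CommRingCat.ofHom_comp]
  congr 3
  ext f
  exact h f

theorem baseChange_isGeneric (ψ : F →+* F') (x : FPoint p φ) (hx : x.IsGeneric) :
    (x.baseChange ψ).IsGeneric := fun Z hZ h => hx Z hZ (by
  rwa [pt_eq_of_specMap (x := x) (y := x.baseChange ψ) rfl] at h)

end BaseChange

/-- The point of an affine open set given by a homomorphism from its coordinate ring. -/
noncomputable def ofAffine {V : X.Opens} (hV : IsAffineOpen V) (ψ : Γ(X, V) →+* F)
    (hψ : ∀ c, ψ (scalarHom p V c) = φ c) : FPoint p φ :=
  ⟨Spec.map (CommRingCat.ofHom ψ) ≫ hV.fromSpec, by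
    have h1 := IsAffineOpen.SpecMap_appLE_fromSpec p (isAffineOpen_top _) hV (by simp)
    rw [IsAffineOpen.fromSpec_top] at h1
    have : φ = ψ.comp (scalarHom p V) := by ext c; exact (hψ c).symm
    rw [Category.assoc, ← h1, this, CommRingCat.ofHom_comp, Spec.map_comp]
    congr 1
    simp only [scalarHom, CommRingCat.ofHom_hom, Spec.map_comp, Scheme.isoSpec_Spec_inv]⟩

theorem pt_ofAffine_mem {V : X.Opens} (hV : IsAffineOpen V) (ψ : Γ(X, V) →+* F)
    (hψ : ∀ c, ψ (scalarHom p V c) = φ c) : (ofAffine (p := p) hV ψ hψ).pt ∈ V := by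
  have : hV.fromSpec (Spec.map (CommRingCat.ofHom ψ) (IsLocalRing.closedPoint F)) ∈
      Set.range hV.fromSpec := ⟨_, rfl⟩
  rw [hV.range_fromSpec] at this
  exact this

theorem eval_ofAffine {V : X.Opens} (hV : IsAffineOpen V) (ψ : Γ(X, V) →+* F)
    (hψ : ∀ c, ψ (scalarHom p V c) = φ c) (h) : (ofAffine (p := p) hV ψ hψ).eval V h = ψ := by
  have h1 := (ofAffine (p := p) hV ψ hψ).specMap_eval_fromSpec hV h
  have h2 := (cancel_mono hV.fromSpec).1 (h1.trans rfl :
    _ = Spec.map (CommRingCat.ofHom ψ) ≫ hV.fromSpec)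
  exact congrArg CommRingCat.Hom.hom (Spec.map_injective h2)

/-- On an irreducible variety, the generic points are the points at which no nonzero regular
function on a given nonempty affine open set vanishes. -/
theorem isGeneric_iff_injective_eval [IrreducibleSpace X] [IsReduced X] (x : FPoint p φ)
    {V : X.Opens} (hV : IsAffineOpen V) (hne : (V : Set X).Nonempty) :
    x.IsGeneric ↔ ∃ h : x.pt ∈ V, ∀ f, x.eval V h f = 0 → f = 0 := by
  constructor
  · intro hx
    have key (W : X.Opens) (hW : x.pt ∉ W) : W = ⊥ := by
      have := hx _ (W.isOpen.isClosed_compl) hW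
      ext1
      simpa using this
    have h : x.pt ∈ V := by
      by_contra h
      simp [key V h] at hne
    refine ⟨h, fun f hf => ?_⟩
    have : x.pt ∉ X.basicOpen f := by rw [x.mem_basicOpen_iff h]; simpa using hf
    exact (basicOpen_eq_bot_iff f).1 (key _ this)
  · rintro ⟨h, hinj⟩ Z hZ hxZ
    by_contra hne'
    obtain ⟨y, hyZ, hyV⟩ := nonempty_preirreducible_inter hZ.isOpen_compl V.isOpen
      (Set.nonempty_compl.2 hne') hne
    obtain ⟨f, hf, hyf⟩ := hV.exists_basicOpen_le (V := ⟨Zᶜ, hZ.isOpen_compl⟩) ⟨y, hyZ⟩ hyV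
    have hx : x.pt ∉ X.basicOpen f := fun hx => hf hx hxZ
    rw [x.mem_basicOpen_iff h, not_not] at hx
    rw [hinj f hx] at hyf
    simp at hyf

end FPoint

theorem finiteType_scalarHom {k : Type} [Field k] {X : Scheme.{0}} {p : X ⟶ Spec (.of k)}
    [LocallyOfFiniteType p] {V : X.Opens} (hV : IsAffineOpen V) : (scalarHom p V).FiniteType := by
  have h1 := LocallyOfFiniteType.finiteType_appLE p (isAffineOpen_top _) hV (by simp)
  simp only [scalarHom, CommRingCat.hom_comp]
  refine h1.comp (RingHom.FiniteType.of_surjective _ ?_)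
  exact (ConcreteCategory.bijective_of_isIso (Scheme.ΓSpecIso (.of k)).inv).2

theorem isDomain_of_irreducible {X : Scheme.{0}} [IrreducibleSpace X] [IsReduced X] {V : X.Opens}
    (hne : (V : Set X).Nonempty) : IsDomain Γ(X, V) := by
  have : IsIntegral X := isIntegral_of_irreducibleSpace_of_isReduced X
  have : Nonempty V := hne.to_subtype
  infer_instance

/-! ### Automorphisms and the property `P(s)` -/

/-- Images of definable sets under automorphisms are definable over the image of the
parameters. -/
theorem definable_image_automorphism {K : Type} [CommRing K] [Differential K] (σ : K ≃+* K)
    (hσ : ∀ x, σ x′ = (σ x)′) {C : Set K} {n : ℕ} {D : Set (Fin n → K)}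
    (h : C.Definable diffRingLang D) :
    (σ '' C).Definable diffRingLang ((fun y i => σ (y i)) '' D) := by
  let e : diffRingLang.Equiv K K :=
    { toEquiv := σ.toEquiv
      map_fun' := by
        intro n f x
        cases f with
        | zero => exact map_zero σ
        | one => exact map_one σ
        | neg => exact map_neg σ _
        | deriv => exact hσ _
        | add => exact map_add σ _ _
        | mul => exact map_mul σ _ _
      map_rel' := by
        intro n r
        exact r.elim }
  rw [Set.definable_iff_exists_formula_sum] at h ⊢
  obtain ⟨φ, rfl⟩ := h
  refine ⟨φ.relabel (Sum.map (fun c : C => (⟨σ c, c, c.2, rfl⟩ : σ '' C)) id), ?_⟩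
  have key (v : Fin n → K) : (φ.relabel (Sum.map
      (fun c : C => (⟨σ c, c, c.2, rfl⟩ : σ '' C)) id)).Realize
      (Sum.elim (↑) fun i => σ (v i)) ↔ φ.Realize (Sum.elim (↑) v) := by
    rw [FirstOrder.Language.Formula.realize_relabel]
    have : (Sum.elim (↑) (fun i => σ (v i)) : (σ '' C) ⊕ Fin n → K) ∘
        Sum.map (fun c : C => (⟨σ c, c, c.2, rfl⟩ : σ '' C)) id =
        (e : K → K) ∘ Sum.elim (↑) v := by
      funext c
      cases c <;> rfl
    rw [this]
    exact FirstOrder.Language.StrongHomClass.realize_formula e φ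
  ext y
  constructor
  · rintro ⟨v, hv, rfl⟩
    exact (key v).2 hv
  · intro hy
    have hy' : (fun i => σ (σ.symm (y i))) = y := by simp
    refine ⟨fun i => σ.symm (y i), (key _).1 ?_, hy'⟩
    rw [hy']
    exact hy

namespace FPoint

variable {k : Type} [Field k] {X : Scheme.{0}} {p : X ⟶ Spec (.of k)}
  {K : Type} [Field K] {φ : k →+* K}

theorem specMap_comp_of_fixed (σ : K →+* K) (hσ : σ.comp φ = φ) (x : FPoint p φ) :
    (Spec.map (CommRingCat.ofHom σ) ≫ x.1) ≫ p = Spec.map (CommRingCat.ofHom φ) := by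
  rw [Category.assoc, x.2, ← Spec.map_comp, ← CommRingCat.ofHom_comp, hσ]

theorem symm_comp_of_fixed {σ : K ≃+* K} (hσ : (σ : K →+* K).comp φ = φ) :
    (σ.symm : K →+* K).comp φ = φ := by
  ext c
  have := congrArg (fun q => q c) hσ
  simpa [RingEquiv.symm_apply_eq] using this.symm

/-- The action of an automorphism of `K` over `k` on the set `X(K)`. -/
noncomputable def conj (σ : K ≃+* K) (hσ : (σ : K →+* K).comp φ = φ) :
    FPoint p φ ≃ FPoint p φ where
  toFun x := ⟨_, x.specMap_comp_of_fixed σ hσ⟩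
  invFun x := ⟨_, x.specMap_comp_of_fixed σ.symm (symm_comp_of_fixed hσ)⟩
  left_inv x := by
    refine Subtype.ext ?_
    change Spec.map (CommRingCat.ofHom _) ≫ Spec.map (CommRingCat.ofHom _) ≫ x.1 = x.1
    rw [← Spec.map_comp_assoc, ← CommRingCat.ofHom_comp]
    have : (σ.symm : K →+* K).comp (σ : K →+* K) = RingHom.id K := by ext; simp
    simp [this]
  right_inv x := by
    refine Subtype.ext ?_
    change Spec.map (CommRingCat.ofHom _) ≫ Spec.map (CommRingCat.ofHom _) ≫ x.1 = x.1
    rw [← Spec.map_comp_assoc, ← CommRingCat.ofHom_comp]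
    have : (σ : K →+* K).comp (σ.symm : K →+* K) = RingHom.id K := by ext; simp
    simp [this]

variable {σ : K ≃+* K} {hσ : (σ : K →+* K).comp φ = φ}

theorem pt_conj (x : FPoint p φ) : (conj σ hσ x).pt = x.pt :=
  pt_eq_of_specMap (ψ := (σ : K →+* K)) rfl

theorem eval_conj (x : FPoint p φ) {V : X.Opens} (h : (conj σ hσ x).pt ∈ V) (h' : x.pt ∈ V)
    (f : Γ(X, V)) : (conj σ hσ x).eval V h f = σ (x.eval V h' f) :=
  eval_of_specMap (ψ := (σ : K →+* K)) rfl h h' f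

theorem field_conj (x : FPoint p φ) : (conj σ hσ x).field = σ '' x.field := by
  ext c
  simp only [Set.mem_image, mem_field_iff]
  constructor
  · rintro ⟨V, h, f, rfl⟩
    exact ⟨_, ⟨V, pt_conj x ▸ h, f, rfl⟩, (eval_conj x h _ f).symm⟩
  · rintro ⟨_, ⟨V, h, f, rfl⟩, rfl⟩
    exact ⟨V, (pt_conj x).symm ▸ h, f, eval_conj x _ h f⟩

theorem coordImage_conj (E : Set (FPoint p φ)) (W : X.Opens) {n : ℕ} (f : Fin n → Γ(X, W)) :
    coordImage (conj σ hσ '' E) W f = (fun y i => σ (y i)) '' coordImage E W f := by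
  ext y
  constructor
  · rintro ⟨_, ⟨x, hx, rfl⟩, h, rfl⟩
    have h' : x.pt ∈ W := pt_conj x ▸ h
    exact ⟨_, ⟨x, hx, h', rfl⟩, by funext i; exact (eval_conj x h h' _).symm⟩
  · rintro ⟨_, ⟨x, hx, h, rfl⟩, rfl⟩
    have h' : (conj σ hσ x).pt ∈ W := (pt_conj x).symm ▸ h
    exact ⟨_, ⟨x, hx, rfl⟩, h', by funext i; exact (eval_conj x h' h _).symm⟩

end FPoint

section Automorphism

open FPoint

variable {k : Type} [Field k] {X : Scheme.{0}} {p : X ⟶ Spec (.of k)}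
  {K : Type} [Field K] [Differential K] {φ : k →+* K}
  {σ : K ≃+* K} {hσ : (σ : K →+* K).comp φ = φ}

theorem DefinableOver.conj (hd : ∀ x, σ x′ = (σ x)′) {C : Set K} {E : Set (FPoint p φ)}
    (h : DefinableOver C E) : DefinableOver (σ '' C) (conj σ hσ '' E) := by
  intro W hW n f hf
  rw [coordImage_conj]
  exact definable_image_automorphism σ hd (h W hW n f hf)

theorem AlgebraicOver.conj (hd : ∀ x, σ x′ = (σ x)′) {C : Set K} {x : FPoint p φ}
    (h : AlgebraicOver C x) : AlgebraicOver (σ '' C) (conj σ hσ x) := by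
  obtain ⟨E, hE, hdef, hx⟩ := h
  exact ⟨_, hE.image _, hdef.conj hd, x, hx, rfl⟩

theorem symm_deriv (hd : ∀ x, σ x′ = (σ x)′) (x : K) : σ.symm x′ = (σ.symm x)′ := by
  rw [RingEquiv.symm_apply_eq, hd, RingEquiv.apply_symm_apply]

theorem IsStronglyMinimalSet.conj (hd : ∀ x, σ x′ = (σ x)′) {D : Set (FPoint p φ)}
    (h : IsStronglyMinimalSet D) : IsStronglyMinimalSet (FPoint.conj σ hσ '' D) := by
  refine ⟨h.1.image (FPoint.conj σ hσ).injective.injOn, fun E hE hdef => ?_⟩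
  have h1 : DefinableOver Set.univ ((FPoint.conj σ hσ).symm '' E) := by
    have := hdef.conj (σ := σ.symm) (hσ := symm_comp_of_fixed hσ) (symm_deriv hd)
    rwa [Set.image_univ, EquivLike.range_eq_univ] at this
  have h2 : (FPoint.conj σ hσ).symm '' E ⊆ D := by
    rintro _ ⟨x, hx, rfl⟩
    obtain ⟨y, hy, rfl⟩ := hE hx
    simpa using hy
  have h3 : E = FPoint.conj σ hσ '' ((FPoint.conj σ hσ).symm '' E) := by simp [Set.image_image]
  refine (h.2 _ h2 h1).imp (fun h => ?_) (fun h => ?_)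
  · rw [h3]; exact h.image _
  · rw [h3, ← Set.image_sdiff (FPoint.conj σ hσ).injective]; exact h.image _

theorem IsDisintegratedOver.conj (hd : ∀ x, σ x′ = (σ x)′) {C : Set K} {D : Set (FPoint p φ)}
    (h : IsDisintegratedOver C D) : IsDisintegratedOver (σ '' C) (conj σ hσ '' D) := by
  rintro A hA _ ⟨x, hx, rfl⟩ halg
  have hC (C' : Set K) (y : FPoint p φ) (h : AlgebraicOver C' (FPoint.conj σ hσ y)) :
      AlgebraicOver (σ.symm '' C') y := by
    have := h.conj (σ := σ.symm) (hσ := symm_comp_of_fixed hσ) (symm_deriv hd)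
    rwa [show FPoint.conj σ.symm (symm_comp_of_fixed hσ) (FPoint.conj σ hσ y) = y from
      (FPoint.conj σ hσ).symm_apply_apply y] at this
  have hA' : (FPoint.conj σ hσ).symm '' A ⊆ D := by
    rintro _ ⟨y, hy, rfl⟩
    obtain ⟨z, hz, rfl⟩ := hA hy
    simpa using hz
  have hfield : σ.symm '' (σ '' C ∪ ⋃ a ∈ A, a.field) =
      C ∪ ⋃ a ∈ (FPoint.conj σ hσ).symm '' A, a.field := by
    rw [Set.image_union, Set.image_iUnion₂, Set.biUnion_image, Set.image_image]
    simp only [RingEquiv.symm_apply_apply, Set.image_id']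
    congr 1
    refine Set.iUnion₂_congr fun a _ => ?_
    exact (field_conj (σ := σ.symm) (hσ := symm_comp_of_fixed hσ) a).symm
  have h1 := hC _ x halg
  rw [hfield] at h1
  refine (h _ hA' x hx h1).imp (fun h => h.conj hd) ?_
  rintro ⟨_, ⟨a, ha, rfl⟩, h⟩
  refine ⟨a, ha, ?_⟩
  have := h.conj (hσ := hσ) hd
  rwa [Set.image_union, ← field_conj (hσ := hσ), Equiv.apply_symm_apply] at this

end Automorphism

theorem countable_mvPolynomial (σ k : Type) [Countable σ] [CommRing k] [Countable k] :
    Countable (MvPolynomial σ k) := by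
  rw [← Cardinal.mk_le_aleph0_iff]
  refine MvPolynomial.cardinalMk_le_max.trans ?_
  simp

theorem countable_of_finiteType (k A : Type) [CommRing k] [CommRing A] [Algebra k A] [Countable k]
    [Algebra.FiniteType k A] : Countable A := by
  obtain ⟨n, f, hf⟩ := Algebra.FiniteType.iff_quotient_mvPolynomial''.1
    (inferInstance : Algebra.FiniteType k A)
  have := countable_mvPolynomial (Fin n) k
  exact hf.countable

namespace VectorFieldFamily

open FPoint

variable {k : Type} [Field k] (fam : VectorFieldFamily k)
  {K : Type} [Field K] [Differential K] {φ : k →+* constantField K}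

theorem conj_mem_solutions {σ : K ≃+* K} (hd : ∀ x, σ x′ = (σ x)′)
    (hσ : (σ : K →+* K).comp ((constantField K).subtype.comp φ) =
      (constantField K).subtype.comp φ) {s s' : FPoint fam.pS φ}
    (h : (s'.baseChange (constantField K).subtype).1 =
      Spec.map (CommRingCat.ofHom (σ : K →+* K)) ≫ (s.baseChange (constantField K).subtype).1)
    {x} (hx : x ∈ fam.solutions s) : conj σ hσ x ∈ fam.solutions s' := by
  refine ⟨?_, fun W hW f => ?_⟩
  · rw [h, ← hx.1]
    exact Category.assoc _ _ _
  · have hW' : x.pt ∈ W := pt_conj x ▸ hW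
    rw [eval_conj x hW hW', eval_conj x hW hW', ← hd, hx.2]

/-- The property `P(s)` is invariant under differential automorphisms. -/
theorem StronglyMinimalDisintegratedAt.of_automorphism {fam : VectorFieldFamily k}
    {σ : K ≃+* K} (hd : ∀ x, σ x′ = (σ x)′) {s s' : FPoint fam.pS φ}
    (h : (s'.baseChange (constantField K).subtype).1 =
      Spec.map (CommRingCat.ofHom (σ : K →+* K)) ≫ (s.baseChange (constantField K).subtype).1)
    (hs : fam.StronglyMinimalDisintegratedAt s) : fam.StronglyMinimalDisintegratedAt s' := by
  have hσ : (σ : K →+* K).comp ((constantField K).subtype.comp φ) =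
      (constantField K).subtype.comp φ := by
    have h1 := (s'.baseChange (constantField K).subtype).2
    rw [h, Category.assoc, (s.baseChange (constantField K).subtype).2, ← Spec.map_comp,
      ← CommRingCat.ofHom_comp] at h1
    exact congrArg CommRingCat.Hom.hom (Spec.map_injective h1)
  have h' : (s.baseChange (constantField K).subtype).1 =
      Spec.map (CommRingCat.ofHom (σ.symm : K →+* K)) ≫
        (s'.baseChange (constantField K).subtype).1 := by
    rw [h, ← Spec.map_comp_assoc, ← CommRingCat.ofHom_comp]
    have : (σ.symm : K →+* K).comp (σ : K →+* K) = RingHom.id K := by ext; simp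
    simp [this]
  have hsol : fam.solutions s' = conj σ hσ '' fam.solutions s := by
    refine Set.Subset.antisymm (fun x hx => ?_) ?_
    · exact ⟨(conj σ hσ).symm x, fam.conj_mem_solutions (symm_deriv hd) (symm_comp_of_fixed hσ) h'
        hx, (conj σ hσ).apply_symm_apply x⟩
    · rintro _ ⟨x, hx, rfl⟩
      exact fam.conj_mem_solutions hd hσ h hx
  have hfield : (s'.baseChange (constantField K).subtype).field =
      σ '' (s.baseChange (constantField K).subtype).field := by
    rw [← field_conj (hσ := hσ)]
    congr 1
    exact Subtype.ext h
  refine ⟨?_, ?_⟩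
  · rw [hsol]; exact hs.1.conj hd
  · rw [hsol, hfield]; exact hs.2.conj hd

/-- By homogeneity of the differential field, `P(s)` is the same for all constant generic points of
an irreducible base. -/
theorem StronglyMinimalDisintegratedAt.of_isGeneric {fam : VectorFieldFamily k} [Countable k]
    [IrreducibleSpace fam.S] (hK : IsDifferentiallyClosed K)
    (hsat : IsSaturatedModel diffRingLang K) (hunc : Cardinal.aleph0 < Cardinal.mk K)
    {s s' : FPoint fam.pS φ} (hs : s.IsGeneric) (hs' : s'.IsGeneric)
    (h : fam.StronglyMinimalDisintegratedAt s) : fam.StronglyMinimalDisintegratedAt s' := by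
  have := fam.variety_S.reduced
  have := fam.variety_S.locallyOfFiniteType
  obtain ⟨V, hV, hsV⟩ := Scheme.exists_isAffineOpen_mem s.pt
  let b (s : FPoint fam.pS φ) := s.baseChange (constantField K).subtype
  have hb (s : FPoint fam.pS φ) (hs : s.IsGeneric) :=
    ((b s).isGeneric_iff_injective_eval hV ⟨_, hsV⟩).1 (baseChange_isGeneric _ s hs)
  obtain ⟨hV₁, hinj₁⟩ := hb s hs
  obtain ⟨hV₂, hinj₂⟩ := hb s' hs'
  have : Countable Γ(fam.S, V) := by
    algebraize [scalarHom fam.pS V]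
    have : Algebra.FiniteType k Γ(fam.S, V) := finiteType_scalarHom hV
    exact countable_of_finiteType k _
  have hconst (s : FPoint fam.pS φ) (h) (f) : ((b s).eval V h f)′ = 0 := by
    have h' : s.pt ∈ V := by
      rwa [pt_eq_of_specMap (x := s) (y := b s) rfl] at h
    rw [eval_of_specMap (x := s) (y := b s) rfl h h']
    exact (s.eval V h' f).2
  obtain ⟨σ, hd, hσ⟩ := exists_automorphism_of_constants hK hsat hunc ((b s).eval V hV₁)
    ((b s').eval V hV₂) ((injective_iff_map_eq_zero _).2 hinj₁)
    ((injective_iff_map_eq_zero _).2 hinj₂) (hconst s hV₁) (hconst s' hV₂)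
  exact h.of_automorphism hd (specMap_of_eval hV hV₂ hV₁ fun f => (hσ f).symm)

end VectorFieldFamily

/-! ### Algebraically independent tuples of complex numbers -/

/-- The zero set of a nonzero polynomial has Lebesgue measure zero. -/
theorem ae_eval_ne_zero {d : ℕ} (p : MvPolynomial (Fin d) ℂ) (hp : p ≠ 0) :
    ∀ᵐ y : Fin d → ℂ, MvPolynomial.eval y p ≠ 0 := by
  induction d with
  | zero =>
    refine Filter.Eventually.of_forall fun y hy => hp ?_
    obtain ⟨c, rfl⟩ := MvPolynomial.C_surjective (Fin 0) p
    simpa using hy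
  | succ d ih =>
    let q := MvPolynomial.finSuccEquiv ℂ d p
    have hq : q.leadingCoeff ≠ 0 := by simpa [q] using hp
    have hpres := MeasureTheory.volume_preserving_piFinSuccAbove (fun _ : Fin (d + 1) => ℂ) 0
    have hcont : Continuous fun z : ℂ × (Fin d → ℂ) =>
        MvPolynomial.eval (Fin.cons z.1 z.2 : Fin (d + 1) → ℂ) p :=
      (MvPolynomial.continuous_eval p).comp (by fun_prop)
    have hmeas : MeasurableSet {z : ℂ × (Fin d → ℂ) |
        MvPolynomial.eval (Fin.cons z.1 z.2 : Fin (d + 1) → ℂ) p ≠ 0} :=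
      (isOpen_compl_singleton.preimage hcont).measurableSet
    have key : ∀ᵐ z : ℂ × (Fin d → ℂ),
        MvPolynomial.eval (Fin.cons z.1 z.2 : Fin (d + 1) → ℂ) p ≠ 0 := by
      refine (MeasureTheory.Measure.ae_prod_iff_ae_ae hmeas).2 ?_
      refine (MeasureTheory.Measure.ae_ae_comm hmeas).2 ?_
      filter_upwards [ih _ hq] with y hy
      have hne : q.map (MvPolynomial.eval y) ≠ 0 := by
        intro h
        apply hy
        have := congrArg (fun r => r.coeff q.natDegree) h
        simpa using this
      refine MeasureTheory.measure_mono_null (t := (q.map (MvPolynomial.eval y)).rootSet ℂ) ?_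
        (Set.Finite.measure_zero (Polynomial.rootSet_finite _ _) _)
      intro t ht
      have ht : MvPolynomial.eval (Fin.cons t y : Fin (d + 1) → ℂ) p = 0 := by simpa using ht
      rw [MvPolynomial.eval_eq_eval_mv_eval'] at ht
      rw [Polynomial.mem_rootSet]
      exact ⟨hne, by simpa [Polynomial.aeval_def] using ht⟩
    have := hpres.quasiMeasurePreserving.ae key
    filter_upwards [this] with y hy
    convert hy using 3
    funext i
    refine Fin.cases ?_ (fun j => ?_) i <;> simp [MeasurableEquiv.piFinSuccAbove, Fin.tail]

/-- Almost every tuple of complex numbers is algebraically independent over a given countable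
field. -/
theorem ae_algebraicIndependent (k : Subfield ℂ) [Countable k] (d : ℕ) :
    ∀ᵐ y : Fin d → ℂ, AlgebraicIndependent k y := by
  have := countable_mvPolynomial (Fin d) k
  have h : ∀ᵐ y : Fin d → ℂ, ∀ p : MvPolynomial (Fin d) k, p ≠ 0 →
      MvPolynomial.aeval y p ≠ 0 := by
    rw [MeasureTheory.ae_all_iff]
    intro p
    by_cases hp : p = 0
    · simp [hp]
    · have hp' : MvPolynomial.map (algebraMap k ℂ) p ≠ 0 := by
        rwa [Ne, map_eq_zero_iff _ (MvPolynomial.map_injective _ (algebraMap k ℂ).injective)]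
      filter_upwards [ae_eval_ne_zero _ hp'] with y hy _
      rwa [MvPolynomial.eval_map, ← MvPolynomial.aeval_def] at hy
  filter_upwards [h] with y hy
  rw [algebraicIndependent_iff]
  exact fun p hp => by_contra fun hp' => hy p hp' hp

/-! ### Étale and finite algebras over polynomial rings -/

/-- A domain which is étale over a subdomain is algebraic over it. -/
theorem isAlgebraic_of_etale (P A : Type) [CommRing P] [CommRing A] [IsDomain P] [IsDomain A]
    [Algebra P A] [Algebra.Etale P A] :
    Function.Injective (algebraMap P A) ∧ Algebra.IsAlgebraic P A := by
  have : Module.Flat P A := Algebra.Smooth.flat P A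
  have hinj : Function.Injective (algebraMap P A) := FaithfulSMul.algebraMap_injective P A
  refine ⟨hinj, ?_⟩
  let E := FractionRing P
  let L := FractionRing A
  let : Algebra E L := FractionRing.liftAlgebra P L
  have : Algebra.FormallyEtale A L := .of_isLocalization (nonZeroDivisors A)
  have : Algebra.FormallyUnramified P L := .comp P A L
  have : Algebra.FormallyUnramified E L := .of_restrictScalars P E L
  have : Algebra.EssFiniteType A L := .of_isLocalization L (nonZeroDivisors A)
  have : Algebra.EssFiniteType P L := .comp P A L
  have : Algebra.EssFiniteType E L := .of_comp P E L
  have : Module.Finite E L := Algebra.FormallyUnramified.finite_of_free E L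
  have : Algebra.IsAlgebraic E L := inferInstance
  have : Algebra.IsAlgebraic P L := (IsFractionRing.comap_isAlgebraic_iff (K := E)).2 this
  exact Algebra.IsAlgebraic.of_injective (IsScalarTower.toAlgHom P A L)
    (IsFractionRing.injective A L)

/-- A domain which is finite over a Noetherian subdomain `P` of characteristic zero is generically
étale over `P`. -/
theorem exists_etale_away (P A : Type) [CommRing P] [CommRing A] [IsDomain P] [IsDomain A]
    [IsNoetherianRing P] [CharZero P] [Algebra P A] [Module.Finite P A]
    (hinj : Function.Injective (algebraMap P A)) :
    ∃ h : A, h ≠ 0 ∧ Algebra.Etale P (Localization.Away h) := by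
  have : FaithfulSMul P A := (faithfulSMul_iff_algebraMap_injective P A).2 hinj
  have : Module.IsTorsionFree P A := inferInstance
  let E := FractionRing P
  let L := Localization.AtPrime (⊥ : Ideal A)
  have hloc (M : Submonoid A) (hM : M = nonZeroDivisors A) :
      IsFractionRing A (Localization M) := by subst hM; infer_instance
  have : IsFractionRing A L := hloc _ (by ext; simp [Ideal.primeCompl])
  let : Field L := IsFractionRing.toField A
  have : FaithfulSMul P L := by
    rw [faithfulSMul_iff_algebraMap_injective, IsScalarTower.algebraMap_eq P A L]
    exact (IsFractionRing.injective A L).comp hinj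
  let : Algebra E L := FractionRing.liftAlgebra P L
  have : CharZero E := inferInstance
  have : Algebra.IsAlgebraic P L := 
    (IsFractionRing.isAlgebraic_iff' P A L).1 inferInstance
  have : Algebra.IsAlgebraic E L := (IsFractionRing.comap_isAlgebraic_iff (A := P)).1 this
  have : Algebra.FormallyEtale E L := .of_isSeparable E L
  have : Algebra.FormallyEtale P E := .of_isLocalization (nonZeroDivisors P)
  have : Algebra.IsEtaleAt P (⊥ : Ideal A) := Algebra.FormallyEtale.comp P E L
  have : Algebra.FinitePresentation P A := Algebra.FinitePresentation.of_finiteType.1 inferInstance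
  obtain ⟨h, hh, het⟩ := Algebra.exists_etale_of_isEtaleAt (R := P) (⊥ : Ideal A)
  exact ⟨h, by simpa using hh, het⟩

/-- An embedding of a domain `P` into an algebraically closed field extends to an algebraic
extension `A` of `P`. If `P` is integrally closed, the value of the extension at an integral element
`θ` may be any root of the minimal polynomial of `θ`. -/
theorem exists_injective_extension {P A M : Type} [CommRing P] [CommRing A] [IsDomain P]
    [IsDomain A] [IsIntegrallyClosed P] [Algebra P A] [FaithfulSMul P A] [Algebra.IsAlgebraic P A]
    [Field M] [IsAlgClosed M] (e : P →+* M) (he : Function.Injective e) {θ : A}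
    (hθ : IsIntegral P θ) {τ : M} (hτ : (minpoly P θ).eval₂ e τ = 0) :
    ∃ ψ : A →+* M, Function.Injective ψ ∧ (∀ c, ψ (algebraMap P A c) = e c) ∧ ψ θ = τ := by
  let E := FractionRing P
  let L := FractionRing A
  let : Algebra E L := FractionRing.liftAlgebra P L
  let e' : E →+* M := IsFractionRing.lift he
  algebraize [e']
  have : Algebra.IsAlgebraic P L := 
    (IsFractionRing.isAlgebraic_iff' P A L).1 inferInstance
  have : Algebra.IsAlgebraic E L := (IsFractionRing.comap_isAlgebraic_iff (A := P)).1 this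
  obtain ⟨ψ, hψ⟩ := IntermediateField.exists_algHom_of_splits_of_aeval (F := E) (E := L) (K := M)
    (fun s => ⟨Algebra.IsIntegral.isIntegral s, IsAlgClosed.splits _⟩)
    (x := algebraMap A L θ) (y := τ) (by
      rw [minpoly.isIntegrallyClosed_eq_field_fractions E L hθ, Polynomial.aeval_def,
        Polynomial.eval₂_map]
      convert hτ
      ext c
      exact IsFractionRing.lift_algebraMap he c)
  refine ⟨(ψ : L →+* M).comp (algebraMap A L), ψ.injective.comp (IsFractionRing.injective A L),
    fun c => ?_, hψ⟩
  rw [RingHom.comp_apply, ← IsScalarTower.algebraMap_apply, IsScalarTower.algebraMap_apply P E L]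
  exact (ψ.commutes _).trans (IsFractionRing.lift_algebraMap he c)

/-! ### Density of the generic points in the analytic topology -/

/-- A monic complex polynomial which is small at `z` has a root close to `z`. -/
theorem exists_root_near {Q : Polynomial ℂ} (hQ : Q.Monic) (hdeg : Q.natDegree ≠ 0) (z : ℂ) :
    ∃ τ, Q.eval τ = 0 ∧ ‖z - τ‖ ^ Q.natDegree ≤ ‖Q.eval z‖ := by
  classical
  have hsplit := (IsAlgClosed.splits Q)
  have hcard : Q.roots.card = Q.natDegree := hsplit.natDegree_eq_card_roots.symm
  have hne : Q.roots.toFinset.Nonempty := by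
    rw [Multiset.toFinset_nonempty]
    intro h
    rw [h] at hcard
    exact hdeg hcard.symm
  obtain ⟨τ, hτ, hmin⟩ := Q.roots.toFinset.exists_min_image (fun t => ‖z - t‖) hne
  refine ⟨τ, (Polynomial.mem_roots'.1 (Multiset.mem_toFinset.1 hτ)).2, ?_⟩
  have hprod : ∀ S : Multiset ℂ, (∀ t ∈ S, ‖z - τ‖ ≤ ‖z - t‖) →
      ‖z - τ‖ ^ S.card ≤ ‖(S.map fun t => z - t).prod‖ := by
    intro S
    induction S using Multiset.induction_on with
    | empty => simp
    | cons a S ih =>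
      intro h
      rw [Multiset.card_cons, pow_succ', Multiset.map_cons, Multiset.prod_cons, norm_mul]
      exact mul_le_mul (h a (Multiset.mem_cons_self _ _))
        (ih fun t ht => h t (Multiset.mem_cons_of_mem ht)) (by positivity) (norm_nonneg _)
  have heval : Q.eval z = (Q.roots.map fun t => z - t).prod := by
    conv_lhs => rw [hsplit.eq_prod_roots_of_monic hQ]
    rw [Polynomial.eval_multiset_prod, Multiset.map_map]
    simp
  rw [heval, ← hcard]
  exact hprod _ fun t ht => hmin t (Multiset.mem_toFinset.2 ht)

open Filter Topology in
/-- The roots of a sequence of monic polynomials with convergent coefficients have a limit along any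
ultrafilter. -/
theorem exists_tendsto_of_roots {P : Type} [CommRing P] (Q : Polynomial P) (hQ : Q.Monic)
    (e : ℕ → P →+* ℂ) (he : ∀ c, ∃ w, Tendsto (fun m => e m c) atTop (𝓝 w)) (z : ℕ → ℂ)
    (hz : ∀ m, Q.eval₂ (e m) (z m) = 0) (𝓤 : Ultrafilter ℕ) :
    ∃ w, Tendsto z 𝓤 (𝓝 w) := by
  have hbd : ∀ c, ∃ C : ℝ, ∀ m, ‖e m c‖ ≤ C := fun c => by
    obtain ⟨w, hw⟩ := he c
    obtain ⟨C, hC⟩ := (Metric.isBounded_range_of_tendsto _ hw).exists_norm_le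
    exact ⟨C, fun m => hC _ ⟨m, rfl⟩⟩
  choose C hC using hbd
  have hC0 (c) : 0 ≤ C c := (norm_nonneg _).trans (hC c 0)
  have key (m : ℕ) : ‖z m‖ ≤ 1 + ∑ j ∈ Finset.range Q.natDegree, C (Q.coeff j) := by
    have hmon : (Q.map (e m)).Monic := hQ.map _
    have hroot : (Q.map (e m)).IsRoot (z m) := by
      rw [Polynomial.IsRoot, Polynomial.eval_map]
      exact hz m
    refine (NNReal.coe_le_coe.2 (hroot.norm_lt_cauchyBound hmon.ne_zero).le).trans ?_
    rw [Polynomial.cauchyBound, hmon.leadingCoeff, hQ.natDegree_map]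
    simp only [nnnorm_one, div_one, NNReal.coe_add, NNReal.coe_one]
    rw [add_comm]
    refine add_le_add_right ?_ _
    have : ((Finset.range Q.natDegree).sup fun j => ‖(Q.map (e m)).coeff j‖₊) ≤
        ∑ j ∈ Finset.range Q.natDegree, (C (Q.coeff j)).toNNReal := by
      refine Finset.sup_le fun j hj => ?_
      refine le_trans ?_ (Finset.single_le_sum (f := fun j => (C (Q.coeff j)).toNNReal)
        (fun _ _ => zero_le) hj)
      rw [← NNReal.coe_le_coe, Real.coe_toNNReal _ (hC0 _), Polynomial.coeff_map]
      exact hC _ m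
    refine (NNReal.coe_le_coe.2 this).trans_eq ?_
    push_cast
    exact Finset.sum_congr rfl fun j _ => Real.coe_toNNReal _ (hC0 _)
  obtain ⟨w, -, hw⟩ := (isCompact_closedBall (0 : ℂ)
    (1 + ∑ j ∈ Finset.range Q.natDegree, C (Q.coeff j))).ultrafilter_le_nhds (𝓤.map z) (by
      rw [le_principal_iff, Ultrafilter.mem_coe, Ultrafilter.mem_map]
      exact Filter.univ_mem' fun m => by simpa using key m)
  exact ⟨w, hw⟩

/-- A finite algebra has only finitely many points over a given point. -/
theorem finite_setOf_algHom_eq (k P B : Type) [Field k] [CommRing P] [CommRing B]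
    [Algebra k B] [Algebra P B] [Module.Finite P B] [Algebra.FiniteType k B] {M : Type} [Field M]
    [Algebra k M] (e : P →+* M) :
    {t : B →ₐ[k] M | ∀ c, t (algebraMap P B c) = e c}.Finite := by
  obtain ⟨n, f, hf⟩ := Algebra.FiniteType.iff_quotient_mvPolynomial''.1
    (inferInstance : Algebra.FiniteType k B)
  let b (i : Fin n) : B := f (.X i)
  have hint (i) : IsIntegral P (b i) := Algebra.IsIntegral.isIntegral _
  choose Q hQ hQ' using hint
  refine Set.Finite.of_finite_image (f := fun t i => t (b i)) ?_ ?_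
  · refine (Set.Finite.pi (t := fun i => ((Q i).map e).rootSet M)
      fun i => Polynomial.rootSet_finite _ _).subset ?_
    rintro _ ⟨t, ht, rfl⟩ i -
    rw [Polynomial.mem_rootSet]
    refine ⟨((hQ i).map e).ne_zero, ?_⟩
    have h1 : e = (t : B →+* M).comp (algebraMap P B) := by ext c; exact (ht c).symm
    rw [Polynomial.aeval_def, Polynomial.eval₂_map, Algebra.algebraMap_self, RingHom.id_comp, h1]
    change Polynomial.eval₂ _ ((t : B →+* M) (b i)) (Q i) = 0
    rw [← Polynomial.hom_eval₂, hQ', map_zero]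
  · intro t _ t' _ h
    have : t.comp f = t'.comp f := by
      ext i
      exact congrFun h i
    ext x
    obtain ⟨x, rfl⟩ := hf x
    exact congrArg (fun q => q x) this

/-- Some element of `B` separates a given point from finitely many others. -/
theorem exists_separating {k B M : Type} [Field k] [Infinite k] [CommRing B] [Algebra k B] [Field M]
    [Algebra k M] (s : B →ₐ[k] M) {T : Set (B →ₐ[k] M)} (hT : T.Finite) :
    ∃ θ : B, ∀ t ∈ T, t θ = s θ → t = s := by
  classical
  let W (t : B →ₐ[k] M) : Subspace k B := LinearMap.eqLocus t.toLinearMap s.toLinearMap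
  have h := Subspace.biUnion_ne_univ_of_top_notMem (k := k) (E := B)
    (s := (hT.toFinset.erase s).image W) (by
      intro h
      obtain ⟨t, ht, htop⟩ := Finset.mem_image.1 h
      refine Finset.ne_of_mem_erase ht ?_
      ext x
      have : x ∈ W t := htop ▸ Submodule.mem_top
      exact this)
  obtain ⟨θ, hθ⟩ := (Set.ne_univ_iff_exists_notMem _).1 h
  refine ⟨θ, fun t ht heq => by_contra fun hne => hθ ?_⟩
  exact Set.mem_biUnion (Finset.mem_coe.2 (Finset.mem_image_of_mem W
    (Finset.mem_erase.2 ⟨hne, hT.mem_toFinset.2 ht⟩))) heq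

open Filter Topology in
/-- Every complex point of an irreducible affine variety `B` over a countable field `k` is a limit
of generic points.

By Noether normalization `B` is finite over a polynomial ring `P`; let `y` be the image of the given
point `s` in affine space. Choose `θ` in `B` separating `s` from the other points above `y`, and
algebraically independent tuples `y_m` converging to `y`. The minimal polynomial of `θ` over `P` has
at `y_m` a root close to `s(θ)`, and the embedding of `P` given by `y_m` extends to an embedding
`t_m` of `B` which maps `θ` to this root. Any limit of the `t_m` lies above `y` and takes the value
`s(θ)` at `θ`, so it is `s`. -/
theorem exists_injective_near (k : Subfield ℂ) [Countable k] (B : Type) [CommRing B] [IsDomain B]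
    [Algebra k B] [Algebra.FiniteType k B] (s : B →ₐ[k] ℂ) {n : ℕ} (f : Fin n → B) {ε : ℝ}
    (hε : 0 < ε) :
    ∃ t : B →ₐ[k] ℂ, Function.Injective t ∧ ∀ i, ‖t (f i) - s (f i)‖ < ε := by
  obtain ⟨d, g, hg, hfin⟩ := exists_finite_inj_algHom_of_fg k B
  let P := MvPolynomial (Fin d) k
  algebraize [g.toRingHom]
  have : Module.Finite P B := hfin
  have : FaithfulSMul P B := (faithfulSMul_iff_algebraMap_injective P B).2 hg
  have hgC (c : k) : algebraMap P B (.C c) = algebraMap k B c := g.commutes c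
  let y (i : Fin d) : ℂ := s (algebraMap P B (.X i))
  have hy (c : P) : s (algebraMap P B c) = MvPolynomial.aeval y c := by
    have : s.comp g = MvPolynomial.aeval y := by ext i; simp [y]; rfl
    exact congrArg (fun q => q c) this
  obtain ⟨θ, hθ⟩ := exists_separating s
    (finite_setOf_algHom_eq k P B (M := ℂ) (MvPolynomial.aeval y : P →ₐ[k] ℂ).toRingHom)
  have hdense : y ∈ closure {y | AlgebraicIndependent k y} :=
    MeasureTheory.Measure.dense_of_ae (ae_algebraicIndependent k d) y
  obtain ⟨u, hu, hlim⟩ := mem_closure_iff_seq_limit.1 hdense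
  let e (m : ℕ) : P →+* ℂ := (MvPolynomial.aeval (u m) : P →ₐ[k] ℂ).toRingHom
  have he (c : P) : Tendsto (fun m => e m c) atTop (𝓝 (MvPolynomial.aeval y c)) := by
    have hc : Continuous fun y : Fin d → ℂ => MvPolynomial.aeval y c := by
      simp only [MvPolynomial.aeval_def, ← MvPolynomial.eval_map]
      exact MvPolynomial.continuous_eval _
    exact (hc.tendsto y).comp hlim
  have hθint : IsIntegral P θ := Algebra.IsIntegral.isIntegral θ
  let Q := minpoly P θ
  have hQ : Q.Monic := minpoly.monic hθint
  have hQdeg : Q.natDegree ≠ 0 := (minpoly.natDegree_pos hθint).ne'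
  have hroot (m : ℕ) : ∃ τ, Q.eval₂ (e m) τ = 0 ∧
      ‖s θ - τ‖ ^ Q.natDegree ≤ ‖Q.eval₂ (e m) (s θ)‖ := by
    have := exists_root_near (hQ.map (e m)) (by rwa [hQ.natDegree_map]) (s θ)
    simpa only [hQ.natDegree_map, Polynomial.eval_map] using this
  choose τ hτ hτ' using hroot
  have hQs : Tendsto (fun m => Q.eval₂ (e m) (s θ)) atTop (𝓝 0) := by
    have h0 : Q.eval₂ (MvPolynomial.aeval y : P →ₐ[k] ℂ).toRingHom (s θ) = 0 := by
      have h1 : (MvPolynomial.aeval y : P →ₐ[k] ℂ).toRingHom =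
          (s : B →+* ℂ).comp (algebraMap P B) := by
        ext c
        · simpa using (hy (.C c)).symm
        · simp [y]
      rw [h1]
      change Polynomial.eval₂ _ ((s : B →+* ℂ) θ) _ = 0
      rw [← Polynomial.hom_eval₂, ← Polynomial.aeval_def, minpoly.aeval, map_zero]
    rw [← h0]
    simp only [Polynomial.eval₂_eq_sum_range]
    exact tendsto_finsetSum _ fun j _ => (he _).mul_const _
  have hτlim : Tendsto τ atTop (𝓝 (s θ)) := by
    rw [tendsto_iff_norm_sub_tendsto_zero]
    have h1 : Tendsto (fun m => ‖s θ - τ m‖ ^ Q.natDegree) atTop (𝓝 0) :=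
      squeeze_zero (fun m => by positivity) hτ' (by simpa using hQs.norm)
    have h2 := h1.rpow_const (p := (Q.natDegree : ℝ)⁻¹) (Or.inr (by positivity))
    rw [Real.zero_rpow (by positivity)] at h2
    refine h2.congr fun m => ?_
    rw [Real.pow_rpow_inv_natCast (norm_nonneg _) hQdeg, norm_sub_rev]
  have hext (m : ℕ) := exists_injective_extension (e m) (hu m) hθint (hτ m)
  choose ψ hψinj hψe hψθ using hext
  let 𝓤 : Ultrafilter ℕ := Filter.hyperfilter ℕ
  have h𝓤 : (𝓤 : Filter ℕ) ≤ atTop := Nat.hyperfilter_le_atTop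
  have hconv (b : B) : ∃ w, Tendsto (fun m => ψ m b) 𝓤 (𝓝 w) := by
    obtain ⟨R, hR, hR'⟩ : IsIntegral P b := Algebra.IsIntegral.isIntegral b
    refine exists_tendsto_of_roots R hR e (fun c => ⟨_, he c⟩) _ (fun m => ?_) 𝓤
    have h1 : e m = (ψ m).comp (algebraMap P B) := RingHom.ext fun c => (hψe m c).symm
    rw [h1, ← Polynomial.hom_eval₂, hR', map_zero]
  choose L hL using hconv
  let t : B →ₐ[k] ℂ :=
    { toFun := L
      map_one' := tendsto_nhds_unique (hL 1) (by simp)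
      map_mul' a b := tendsto_nhds_unique (hL _) (by simpa using (hL a).mul (hL b))
      map_zero' := tendsto_nhds_unique (hL 0) (by simp)
      map_add' a b := tendsto_nhds_unique (hL _) (by simpa using (hL a).add (hL b))
      commutes' c := by
        refine tendsto_nhds_unique (hL _) ?_
        simp only [← hgC, hψe]
        simpa using (he (.C c)).mono_left h𝓤 }
  have ht : t = s := by
    refine hθ t (fun c => ?_) ?_
    · refine tendsto_nhds_unique (hL _) ?_
      simp only [hψe]
      exact (he c).mono_left h𝓤
    · refine tendsto_nhds_unique (hL _) ?_
      simp only [hψθ]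
      exact hτlim.mono_left h𝓤
  have hev : ∀ᶠ m in (𝓤 : Filter ℕ), ∀ i, ‖ψ m (f i) - s (f i)‖ < ε := by
    rw [eventually_all]
    intro i
    have h1 : Tendsto (fun m => ψ m (f i)) 𝓤 (𝓝 (s (f i))) := by
      rw [← ht]; exact hL (f i)
    simpa [dist_eq_norm] using (Metric.tendsto_nhds.1 h1) ε hε
  obtain ⟨m, hm⟩ := hev.exists
  refine ⟨{ ψ m with commutes' := fun c => ?_ }, hψinj m, hm⟩
  change ψ m _ = _
  rw [← hgC, hψe]
  exact (MvPolynomial.aeval (u m) : P →ₐ[k] ℂ).commutes c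

/-! ### The analytic topology -/

theorem scalarHom_res {k : Type} [Field k] {X : Scheme.{0}} (p : X ⟶ Spec (.of k))
    {V W : X.Opens} (i : W ≤ V) (c : k) :
    X.presheaf.map (homOfLE i).op (scalarHom p V c) = scalarHom p W c := by
  have hV : V ≤ p ⁻¹ᵁ ⊤ := le_top
  have hW : W ≤ p ⁻¹ᵁ ⊤ := le_top
  have : (Scheme.ΓSpecIso (.of k)).inv ≫ p.appLE ⊤ V hV ≫ X.presheaf.map (homOfLE i).op =
      (Scheme.ΓSpecIso (.of k)).inv ≫ p.appLE ⊤ W hW := by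
    rw [Scheme.Hom.appLE_map]
  exact congrArg (fun q => q.hom c) this

namespace FPoint

section Chart

variable {k : Type} [Field k] {X : Scheme.{0}} {p : X ⟶ Spec (.of k)}
  {F : Type} [Field F] {φ : k →+* F}

/-- The coordinates of the points of an open set with respect to finitely many regular
functions. -/
noncomputable def chart (V : X.Opens) {n : ℕ} (f : Fin n → Γ(X, V)) (x : {x : FPoint p φ // x.pt ∈ V}) :
    Fin n → F :=
  fun i => x.1.eval V x.2 (f i)

theorem eval_eval₂Hom (x : FPoint p φ) {V : X.Opens} (h : x.pt ∈ V) {n : ℕ} (f : Fin n → Γ(X, V))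
    (q : MvPolynomial (Fin n) k) :
    x.eval V h (MvPolynomial.eval₂Hom (scalarHom p V) f q) =
      MvPolynomial.eval₂ φ (fun i => x.eval V h (f i)) q := by
  have : (x.eval V h).comp (MvPolynomial.eval₂Hom (scalarHom p V) f) =
      MvPolynomial.eval₂Hom φ (fun i => x.eval V h (f i)) := by
    ext c
    · simp [eval_scalarHom]
    · simp
  exact congrArg (fun r => r q) this

theorem exists_chart [LocallyOfFiniteType p] {V : X.Opens} (hV : IsAffineOpen V) :
    ∃ (n : ℕ) (f : Fin n → Γ(X, V)),
      Function.Surjective (MvPolynomial.eval₂Hom (scalarHom p V) f) := by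
  algebraize [scalarHom p V]
  have : Algebra.FiniteType k Γ(X, V) := finiteType_scalarHom hV
  obtain ⟨n, g, hg⟩ := Algebra.FiniteType.iff_quotient_mvPolynomial''.1 this
  refine ⟨n, fun i => g (.X i), ?_⟩
  have : (MvPolynomial.eval₂Hom (scalarHom p V) fun i => g (.X i)) = (g : _ →+* Γ(X, V)) := by
    ext c
    · simp only [RingHom.comp_apply, MvPolynomial.eval₂Hom_C]
      exact (g.commutes c).symm
    · simp
  rw [this]
  exact hg

end Chart

section Complex

variable {k : Type} [Field k] {X : Scheme.{0}} {p : X ⟶ Spec (.of k)} {φ : k →+* ℂ}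

theorem isOpen_setOf_eval_mem (V : X.Opens) (f : Γ(X, V)) {O : Set ℂ} (hO : IsOpen O) :
    IsOpen {x : FPoint p φ | ∃ h : x.pt ∈ V, x.eval V h f ∈ O} :=
  TopologicalSpace.isOpen_generateFrom_of_mem ⟨V, f, O, hO, rfl⟩

theorem isOpen_setOf_pt_mem (V : X.Opens) : IsOpen {x : FPoint p φ | x.pt ∈ V} := by
  simpa using isOpen_setOf_eval_mem (p := p) (φ := φ) V 0 isOpen_univ

theorem continuous_eval₂ {n : ℕ} (q : MvPolynomial (Fin n) k) :
    Continuous fun y : Fin n → ℂ => MvPolynomial.eval₂ φ y q := by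
  simp only [← MvPolynomial.eval_map]
  exact MvPolynomial.continuous_eval _

/-- An affine chart embeds the points of an affine open set, with the analytic topology, as a closed
subset of affine space. -/
theorem isClosedEmbedding_chart {V : X.Opens} (hV : IsAffineOpen V) {n : ℕ} (f : Fin n → Γ(X, V))
    (hf : Function.Surjective (MvPolynomial.eval₂Hom (scalarHom p V) f)) :
    Topology.IsClosedEmbedding (chart (p := p) (φ := φ) V f) := by
  have heval (x : {x : FPoint p φ // x.pt ∈ V}) (q) :
      x.1.eval V x.2 (MvPolynomial.eval₂Hom (scalarHom p V) f q) =
        MvPolynomial.eval₂ φ (chart V f x) q := x.1.eval_eval₂Hom x.2 f q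
  refine ⟨⟨⟨le_antisymm ?_ ?_⟩, ?_⟩, ?_⟩
  · rw [← continuous_iff_le_induced]
    refine continuous_pi fun i => continuous_def.2 fun O hO => ?_
    convert (isOpen_setOf_eval_mem (p := p) (φ := φ) V (f i) hO).preimage continuous_subtype_val
    ext x
    exact ⟨fun h => ⟨x.2, h⟩, fun ⟨_, h⟩ => h⟩
  · rw [instTopologicalSpaceSubtype, analyticTopology, induced_generateFrom_eq]
    refine le_generateFrom ?_
    rintro _ ⟨_, ⟨V', g, O, hO, rfl⟩, rfl⟩
    refine (@isOpen_iff_forall_mem_open _ (TopologicalSpace.induced (chart V f) _) _).2 ?_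
    rintro x ⟨hx', hxO⟩
    -- near `x`, the function `g` is a quotient `a / b ^ m` of functions on `V`
    obtain ⟨b, hb, hxb⟩ := hV.exists_basicOpen_le (V := V') ⟨x.1.pt, hx'⟩ x.2
    have := hV.isLocalization_basicOpen b
    obtain ⟨⟨a, _, m, rfl⟩, ha⟩ := IsLocalization.surj (Submonoid.powers b)
      (X.presheaf.map (homOfLE hb).op g)
    obtain ⟨qa, rfl⟩ := hf a
    obtain ⟨qb, rfl⟩ := hf b
    have key (z : {x : FPoint p φ // x.pt ∈ V}) (hz : MvPolynomial.eval₂ φ (chart V f z) qb ≠ 0) :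
        ∃ h : z.1.pt ∈ V', z.1.eval V' h g =
          MvPolynomial.eval₂ φ (chart V f z) qa / MvPolynomial.eval₂ φ (chart V f z) qb ^ m := by
      rw [← heval, ← mem_basicOpen_iff] at hz
      refine ⟨hb hz, ?_⟩
      have hres (c : Γ(X, V)) : z.1.eval _ hz (algebraMap Γ(X, V) Γ(X, X.basicOpen _) c) =
          z.1.eval V z.2 c := z.1.eval_res (X.basicOpen_le _) hz c
      have h1 := congrArg (z.1.eval _ hz) ha
      rw [map_mul, hres, hres, map_pow, z.1.eval_res hb hz, heval] at h1
      replace h1 := h1.trans (heval z qa)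
      rw [mem_basicOpen_iff _ z.2, heval] at hz
      rw [eq_div_iff (pow_ne_zero _ hz), h1]
    let N : Set (Fin n → ℂ) := {y | MvPolynomial.eval₂ φ y qb ≠ 0} ∩
      (fun y => MvPolynomial.eval₂ φ y qa / MvPolynomial.eval₂ φ y qb ^ m) ⁻¹' O
    have hN : IsOpen N := by
      refine ContinuousOn.isOpen_inter_preimage ?_
        (isOpen_compl_singleton.preimage (continuous_eval₂ qb)) hO
      exact (continuous_eval₂ qa).continuousOn.div ((continuous_eval₂ qb).pow m).continuousOn
        fun y hy => pow_ne_zero _ hy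
    refine ⟨chart V f ⁻¹' N, fun z hz => ?_, ⟨N, hN, rfl⟩, ?_⟩
    · obtain ⟨h, h'⟩ := key z hz.1
      exact ⟨h, h' ▸ hz.2⟩
    · have hx : MvPolynomial.eval₂ φ (chart V f x) qb ≠ 0 := by
        rw [← heval]
        exact (x.1.mem_basicOpen_iff x.2 _).1 hxb
      obtain ⟨h, h'⟩ := key x hx
      rw [h'] at hxO
      exact ⟨hx, hxO⟩
  · intro x y hxy
    refine Subtype.ext (ext_of_eval hV x.2 y.2 ?_)
    ext a
    obtain ⟨q, rfl⟩ := hf a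
    rw [heval, heval, hxy]
  · have : Set.range (chart (p := p) (φ := φ) V f) =
        ⋂ q ∈ RingHom.ker (MvPolynomial.eval₂Hom (scalarHom p V) f),
          {y | MvPolynomial.eval₂ φ y q = 0} := by
      ext y
      simp only [Set.mem_iInter]
      constructor
      · rintro ⟨x, rfl⟩ q hq
        have hq : MvPolynomial.eval₂Hom (scalarHom p V) f q = 0 := hq
        rw [Set.mem_ofPred_eq, ← heval, hq, map_zero]
      · intro hy
        let ψ : Γ(X, V) →+* ℂ := (MvPolynomial.eval₂Hom (scalarHom p V) f).liftOfSurjective hf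
          ⟨MvPolynomial.eval₂Hom φ y, hy⟩
        have hψ (q) : ψ (MvPolynomial.eval₂Hom (scalarHom p V) f q) =
            MvPolynomial.eval₂Hom φ y q := RingHom.liftOfRightInverse_comp_apply _ _ _ _ q
        have hψ' (c) : ψ (scalarHom p V c) = φ c := by simpa using hψ (.C c)
        refine ⟨⟨ofAffine hV ψ hψ', pt_ofAffine_mem hV ψ hψ'⟩, ?_⟩
        funext i
        rw [chart, eval_ofAffine]
        simpa using hψ (.X i)
    rw [this]
    exact isClosed_biInter fun q _ => isClosed_singleton.preimage (continuous_eval₂ q)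

end Complex

end FPoint

/-! ### Generic complex points -/

namespace FPoint

variable {k : Subfield ℂ} [Countable k] {S : Scheme.{0}} [IrreducibleSpace S]
  {p : S ⟶ Spec (.of k)}

theorem isGδ_isGeneric (hp : IsVariety p) : IsGδ {x : FPoint p k.subtype | x.IsGeneric} := by
  have := hp.locallyOfFiniteType
  have := hp.reduced
  obtain ⟨V, hV, hsV⟩ := Scheme.exists_isAffineOpen_mem (genericPoint S)
  algebraize [scalarHom p V]
  have : Algebra.FiniteType k Γ(S, V) := finiteType_scalarHom hV
  have : Countable Γ(S, V) := countable_of_finiteType k _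
  have hne : (V : Set S).Nonempty := ⟨_, hsV⟩
  have hdom := isDomain_of_irreducible (X := S) hne
  have heq : {x : FPoint p k.subtype | x.IsGeneric} = ⋂ b : {b : Γ(S, V) // b ≠ 0},
      {x | ∃ h : x.pt ∈ V, x.eval V h b.1 ∈ ({0}ᶜ : Set ℂ)} := by
    ext x
    rw [Set.mem_ofPred_eq, isGeneric_iff_injective_eval x hV hne, Set.mem_iInter]
    constructor
    · rintro ⟨h, hinj⟩ b
      exact ⟨h, fun h0 => b.2 (hinj _ h0)⟩
    · intro hx
      obtain ⟨h, -⟩ := hx ⟨1, one_ne_zero⟩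
      exact ⟨h, fun b hb => by_contra fun hb' => (hx ⟨b, hb'⟩).2 hb⟩
  rw [heq]
  exact .iInter fun b => (isOpen_setOf_eval_mem V b.1 isOpen_compl_singleton).isGδ

/-- In an affine chart, the generic points are dense in the analytic topology. -/
theorem dense_isGeneric_of_isAffineOpen (hp : IsVariety p) {V : S.Opens} (hV : IsAffineOpen V) :
    Dense {x : {x : FPoint p k.subtype // x.pt ∈ V} | x.1.IsGeneric} := by
  have := hp.locallyOfFiniteType
  have := hp.reduced
  obtain ⟨n, f, hf⟩ := exists_chart (p := p) hV
  have hemb := isClosedEmbedding_chart (p := p) (φ := k.subtype) hV f hf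
  algebraize [scalarHom p V]
  have : Algebra.FiniteType k Γ(S, V) := finiteType_scalarHom hV
  intro x
  have hne : (V : Set S).Nonempty := ⟨_, x.2⟩
  have hdom := isDomain_of_irreducible (X := S) hne
  rw [hemb.isInducing.closure_eq_preimage_closure_image, Set.mem_preimage, Metric.mem_closure_iff]
  intro ε hε
  let s : Γ(S, V) →ₐ[k] ℂ :=
    { x.1.eval V x.2 with commutes' := fun c => x.1.eval_scalarHom V x.2 c }
  obtain ⟨t, ht, htε⟩ := exists_injective_near k Γ(S, V) s f hε
  have htc (c : k) : (t : Γ(S, V) →+* ℂ) (scalarHom p V c) = k.subtype c := t.commutes c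
  have hmem := pt_ofAffine_mem (p := p) hV (t : Γ(S, V) →+* ℂ) htc
  refine ⟨_, ⟨⟨ofAffine hV (t : Γ(S, V) →+* ℂ) htc, hmem⟩, ?_, rfl⟩, ?_⟩
  · refine (isGeneric_iff_injective_eval _ hV hne).2 ⟨hmem, fun b hb => ?_⟩
    rw [eval_ofAffine] at hb
    exact (map_eq_zero_iff t ht).1 hb
  · rw [dist_comm, dist_pi_lt_iff hε]
    intro i
    rw [dist_eq_norm, chart, chart, eval_ofAffine]
    exact htε i

theorem dense_isGeneric (hp : IsVariety p) : Dense {x : FPoint p k.subtype | x.IsGeneric} := by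
  intro x
  obtain ⟨V, hV, hxV⟩ := Scheme.exists_isAffineOpen_mem x.pt
  have h := dense_isGeneric_of_isAffineOpen hp hV (⟨x, hxV⟩ : {x : FPoint p k.subtype // x.pt ∈ V})
  rw [closure_subtype] at h
  refine closure_mono ?_ h
  rintro _ ⟨y, hy, rfl⟩
  exact hy

/-- A somewhere dense `G_δ` set of complex points contains a generic point: the points of an affine
open set form a Baire space, in which the generic points are a dense `G_δ` set. -/
theorem exists_isGeneric_mem_of_isGδ (hp : IsVariety p) {A : Set (FPoint p k.subtype)}
    (hA : IsGδ A) (hne : (interior (closure A)).Nonempty) : ∃ x ∈ A, x.IsGeneric := by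
  have := hp.locallyOfFiniteType
  obtain ⟨x, hx⟩ := hne
  obtain ⟨V, hV, hxV⟩ := Scheme.exists_isAffineOpen_mem x.pt
  obtain ⟨n, f, hf⟩ := exists_chart (p := p) hV
  have hemb := isClosedEmbedding_chart (p := p) (φ := k.subtype) hV f hf
  let Y := {x : FPoint p k.subtype // x.pt ∈ V}
  have : LocallyCompactSpace Y := hemb.locallyCompactSpace
  have : T2Space Y := hemb.isEmbedding.t2Space
  let i : Y → FPoint p k.subtype := Subtype.val
  have hi : Continuous i := continuous_subtype_val
  have hiopen : IsOpenMap i := (isOpen_setOf_pt_mem V).isOpenMap_subtype_val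
  let A' : Set Y := i ⁻¹' A
  have hA' : IsGδ A' := hA.preimage hi
  have hG : IsGδ {x : Y | x.1.IsGeneric} := (isGδ_isGeneric hp).preimage hi
  have hA'' : IsGδ (A' ∪ (closure A')ᶜ) := hA'.union isClosed_closure.isOpen_compl.isGδ
  have hdense : Dense (A' ∪ (closure A')ᶜ) := by
    intro z
    by_cases hz : z ∈ closure A'
    · exact closure_mono Set.subset_union_left hz
    · exact subset_closure (Or.inr hz)
  have hcl : i ⁻¹' interior (closure A) ⊆ closure A' := by
    rw [← hiopen.preimage_closure_eq_closure_preimage hi]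
    exact Set.preimage_mono interior_subset
  obtain ⟨z, hzO, hzA, hzG⟩ := (hdense.inter_of_Gδ hA'' hG
    (dense_isGeneric_of_isAffineOpen hp hV)).inter_open_nonempty _
    (isOpen_interior.preimage hi) ⟨⟨x, hxV⟩, hx⟩
  exact ⟨z.1, hzA.resolve_right fun h => h (hcl hzO), hzG⟩

/-- In étale coordinates, non-generic points are mapped to tuples which are not algebraically
independent over `k`. -/
theorem lebesgueNull_not_isGeneric (hp : IsVariety p) :
    LebesgueNull {x : FPoint p k.subtype | ¬x.IsGeneric} := by
  have := hp.reduced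
  intro W hW d f hf
  refine MeasureTheory.measure_mono_null ?_ (ae_algebraicIndependent k d)
  rintro _ ⟨x, hx, h, rfl⟩ hind
  refine hx ((isGeneric_iff_injective_eval x hW ⟨_, h⟩).2 ⟨h, fun b hb => by_contra fun hb' => ?_⟩)
  have hdom := isDomain_of_irreducible (X := S) (V := W) ⟨_, h⟩
  algebraize [MvPolynomial.eval₂Hom (scalarHom p W) f]
  have : Algebra.Etale (MvPolynomial (Fin d) k) Γ(S, W) := hf
  obtain ⟨-, halg⟩ := isAlgebraic_of_etale (MvPolynomial (Fin d) k) Γ(S, W)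
  -- a nonzero multiple of `b` is a polynomial in the coordinates
  obtain ⟨c, hc, e, hce⟩ := (halg.isAlgebraic b).exists_nonzero_dvd
    (mem_nonZeroDivisors_of_ne_zero hb')
  refine hc (hind ?_)
  rw [map_zero]
  have h1 := congrArg (x.eval W h) hce
  rw [map_mul, hb, zero_mul] at h1
  exact (x.eval_eval₂Hom h f c).symm.trans h1

/-- In the étale coordinates obtained from Noether normalization, the generic points are mapped onto
all tuples that are algebraically independent over `k`. -/
theorem not_lebesgueNull_isGeneric (hp : IsVariety p) :
    ¬LebesgueNull {x : FPoint p k.subtype | x.IsGeneric} := by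
  have := hp.reduced
  have := hp.locallyOfFiniteType
  obtain ⟨V, hV, hsV⟩ := Scheme.exists_isAffineOpen_mem (genericPoint S)
  have hne : (V : Set S).Nonempty := ⟨_, hsV⟩
  have hdom := isDomain_of_irreducible (X := S) hne
  algebraize [scalarHom p V]
  have : Algebra.FiniteType k Γ(S, V) := finiteType_scalarHom hV
  obtain ⟨d, g, hg, hfin⟩ := exists_finite_inj_algHom_of_fg k Γ(S, V)
  let P := MvPolynomial (Fin d) k
  algebraize [g.toRingHom]
  have : Module.Finite P Γ(S, V) := hfin
  have : FaithfulSMul P Γ(S, V) := (faithfulSMul_iff_algebraMap_injective P _).2 hg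
  obtain ⟨b, hb, het⟩ := exists_etale_away P Γ(S, V) hg
  let W := S.basicOpen b
  have hW : IsAffineOpen W := hV.basicOpen b
  have hloc : IsLocalization.Away b Γ(S, W) := hV.isLocalization_basicOpen b
  let res : Γ(S, V) →+* Γ(S, W) := (S.presheaf.map (homOfLE (S.basicOpen_le b)).op).hom
  let f (i : Fin d) : Γ(S, W) := res (g (.X i))
  have hf : MvPolynomial.eval₂Hom (scalarHom p W) f = res.comp (algebraMap P Γ(S, V)) := by
    ext c
    · simp only [RingHom.comp_apply, MvPolynomial.eval₂Hom_C]
      refine (scalarHom_res p (S.basicOpen_le b) c).symm.trans ?_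
      exact congrArg res (g.commutes c).symm
    · simp [f]; rfl
  intro hnull
  have hetale : (MvPolynomial.eval₂Hom (scalarHom p W) f).Etale := by
    algebraize [MvPolynomial.eval₂Hom (scalarHom p W) f]
    have : IsScalarTower P Γ(S, V) Γ(S, W) := .of_algebraMap_eq' hf
    exact Algebra.Etale.of_equiv ((IsLocalization.algEquiv (Submonoid.powers b)
      (Localization.Away b) Γ(S, W)).restrictScalars P)
  have h0 := hnull W hW d f hetale
  have hev : ∀ᵐ y : Fin d → ℂ, y ∉ coordImage {x : FPoint p k.subtype | x.IsGeneric} W f :=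
    MeasureTheory.measure_eq_zero_iff_ae_notMem.1 h0
  obtain ⟨y, hy, hy'⟩ := (hev.and (ae_algebraicIndependent k d)).exists
  refine hy ?_
  obtain ⟨ψ, hψ, hψe, -⟩ := exists_injective_extension (A := Γ(S, V))
    (MvPolynomial.aeval y : P →ₐ[k] ℂ).toRingHom hy' (θ := 0) (τ := 0) isIntegral_zero
    (by
      have h1 := minpoly.aeval P (0 : Γ(S, V))
      rw [← Polynomial.coeff_zero_eq_aeval_zero', map_eq_zero_iff _
        (FaithfulSMul.algebraMap_injective P Γ(S, V))] at h1
      rw [Polynomial.eval₂_at_zero, h1, map_zero])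
  have hψc (c : k) : ψ (scalarHom p V c) = k.subtype c := by
    have := hψe (.C c)
    rw [show algebraMap P Γ(S, V) (.C c) = scalarHom p V c from g.commutes c] at this
    rw [this]
    exact (MvPolynomial.aeval y : P →ₐ[k] ℂ).commutes c
  have hmem := pt_ofAffine_mem (p := p) hV ψ hψc
  have hmemW : (ofAffine (p := p) hV ψ hψc).pt ∈ W := by
    rw [mem_basicOpen_iff _ hmem, eval_ofAffine]
    exact (map_ne_zero_iff ψ hψ).2 hb
  refine ⟨ofAffine hV ψ hψc, ?_, hmemW, ?_⟩
  · refine (isGeneric_iff_injective_eval _ hV hne).2 ⟨hmem, fun b hb => ?_⟩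
    rw [eval_ofAffine] at hb
    exact (map_eq_zero_iff ψ hψ).1 hb
  · funext i
    refine Eq.trans ?_ (eval_res _ (S.basicOpen_le b) hmemW _).symm
    rw [eval_ofAffine]
    refine Eq.trans ?_ (hψe (.X i)).symm
    simp

end FPoint

open FPoint in
theorem proposition3p2p3
    -- a saturated model `U` of `DCF₀`, with the complex numbers embedded in its constants
    (U : Type) [Field U] [Differential U]
    (hU : IsDifferentiallyClosed U) (hsat : IsSaturatedModel diffRingLang U)
    (ι : ℂ →+* constantField U)
    -- a countable field `k ⊆ ℂ` and a family over `k` with irreducible base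
    (k : Subfield ℂ) [Countable k]
    (fam : VectorFieldFamily k) (hS : IrreducibleSpace fam.S) :
    List.TFAE [
      -- (i) `P(s)` holds on a measurable set of complex points of positive Lebesgue measure
      ∃ A : Set (FPoint fam.pS k.subtype), LebesgueMeasurable A ∧ ¬ LebesgueNull A ∧
        ∀ s ∈ A, fam.StronglyMinimalDisintegratedAt (s.baseChange ι),
      -- (ii) `P(s)` holds on a somewhere dense `G_δ` set of complex points
      ∃ A : Set (FPoint fam.pS k.subtype), IsGδ A ∧ (interior (closure A)).Nonempty ∧
        ∀ s ∈ A, fam.StronglyMinimalDisintegratedAt (s.baseChange ι),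
      -- (iii), (iv) `P(s)` holds for some, resp. any, realization in `S(ℂ)` of the generic type of `S`
      ∃ s : FPoint fam.pS k.subtype,
        s.IsGeneric ∧ fam.StronglyMinimalDisintegratedAt (s.baseChange ι),
      ∀ s : FPoint fam.pS k.subtype,
        s.IsGeneric → fam.StronglyMinimalDisintegratedAt (s.baseChange ι),
      -- the same for realizations in the field of constants of `U`
      ∃ s : FPoint fam.pS (ι.comp k.subtype),
        s.IsGeneric ∧ fam.StronglyMinimalDisintegratedAt s,
      ∀ s : FPoint fam.pS (ι.comp k.subtype),
        s.IsGeneric → fam.StronglyMinimalDisintegratedAt s] := by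
  have hp := fam.variety_S
  have hunc : Cardinal.aleph0 < Cardinal.mk U := by
    have h1 : Cardinal.mk ℂ ≤ Cardinal.mk U :=
      Cardinal.mk_le_of_injective (((constantField U).subtype.comp ι).injective)
    rw [Cardinal.mk_complex] at h1
    exact Cardinal.aleph0_lt_continuum.trans_le h1
  have hGδ := isGδ_isGeneric (p := fam.pS) hp
  have hnotnull := not_lebesgueNull_isGeneric (p := fam.pS) hp
  obtain ⟨s₀, hs₀⟩ : ∃ s : FPoint fam.pS k.subtype, s.IsGeneric := by
    by_contra! h
    exact hnotnull fun W hW d f hf => by simp [coordImage, h]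
  tfae_have 6 → 4 := fun h s hs => h _ (baseChange_isGeneric ι s hs)
  tfae_have 4 → 3 := fun h => ⟨s₀, hs₀, h s₀ hs₀⟩
  tfae_have 3 → 5 := fun ⟨s, hs, h⟩ => ⟨_, baseChange_isGeneric ι s hs, h⟩
  tfae_have 5 → 6 := fun ⟨s, hs, h⟩ s' hs' => h.of_isGeneric hU hsat hunc hs hs'
  tfae_have 4 → 1 := fun h => by
    refine ⟨{s | s.IsGeneric}, ⟨{s | s.IsGeneric}, ?_, ?_⟩, hnotnull, h⟩
    · obtain ⟨T, hT, hTc, hTeq⟩ := hGδ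
      rw [hTeq]
      exact @MeasurableSet.sInter _ (borel _) _ hTc fun t ht =>
        MeasurableSpace.measurableSet_generateFrom (hT t ht)
    · rw [symmDiff_self]
      intro W hW d f hf
      simp [coordImage]
  tfae_have 4 → 2 := fun h => by
    refine ⟨{s | s.IsGeneric}, hGδ, ?_, h⟩
    rw [(dense_isGeneric hp).closure_eq, interior_univ]
    exact ⟨s₀, trivial⟩
  tfae_have 1 → 3 := fun ⟨A, _, hA, h⟩ => by
    by_contra! hcon
    refine hA fun W hW d f hf => ?_
    refine MeasureTheory.measure_mono_null ?_
      (lebesgueNull_not_isGeneric (p := fam.pS) hp W hW d f hf)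
    rintro _ ⟨s, hs, hsW, rfl⟩
    exact ⟨s, fun hgen => hcon s hgen (h s hs), hsW, rfl⟩
  tfae_have 2 → 3 := fun ⟨A, hA, hne, h⟩ => by
    obtain ⟨s, hs, hgen⟩ := exists_isGeneric_mem_of_isGδ hp hA hne
    exact ⟨s, hgen, h s hs⟩
  tfae_finish
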